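/- There is an absolute constant $c>0$ such that for every finite field $\mathbb{F}$, every element $a\in\mathbb{F}\setminus\{0\}$, and all integers $n>r\ge 0$, \[ Q^{*}_{\frac12-\frac{1}{4|\mathbb{F}|^{r/3}}}\bigl(\mathrm{RANKDET}^{\mathbb{F},n}_{r,a}\bigr)\;\ge\; c\,(1+r^{2}\log_2|\mathbb{F}|). \] Here $\mathrm{RANKDET}^{\mathbb{F},n}_{r,a}\colon\mathbb{F}^{n\times n}\times\mathbb{F}^{n\times n}\to\{-1,1,*\}$ is the two-party communication problem in which Alice is given $A$, Bob is given $B$, and \[ \mathrm{RANKDET}^{\mathbb{F},n}_{r,a}(A,B)=\begin{cases}-1&\text{if }\operatorname{rk}(A+B)=r,\\ 1&\text{if }\det(A+B)=a,\\ *&\text{otherwise.}\end{cases} \] For a partial function $f\colon X\times Y\to\{-1,1,*\}$, $Q^{*}_{\epsilon}(f)$ denotes its $\epsilon$-error quantum communication complexity with arbitrary prior entanglement: the least number of qubits exchanged by a two-party quantum protocol, whose parties may share an arbitrary input-independent entangled state at the start, that on every input $(x,y)$ with $f(x,y)\ne *$ outputs $f(x,y)$ with probability at least $1-\epsilon$ (its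 behavior on other inputs is arbitrary). -/

import Mathlib

open scoped Matrix ENNReal

universe u v

/-- The message phase and the final measurement of a two-party quantum protocol with input sets
`X` (Alice) and `Y` (Bob), started when Alice's register has dimension `a` and Bob's register has
dimension `b`. Throughout, a pure state in `ℂ^a ⊗ ℂ^b` is written as the `a × b` matrix `ψ` of its
amplitudes (`ψ i j` is the amplitude of `|i⟩|j⟩`), so that `U ⊗ 1` acts as `ψ ↦ U * ψ` and `1 ⊗ V`
acts as `ψ ↦ ψ * Vᵀ`.

A party that sends a message first applies to its own register an isometry that depends only on
its own input (unitaries, and the adjunction of fresh ancillas, are special cases), splitting the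
register into a part that it keeps and one qubit, and then hands the qubit over. Messages of
several qubits are sent qubit by qubit, and the order of the speakers is arbitrary.

At the end one of the parties applies to its register a two-outcome projective measurement
`{P, 1 - P}` that depends only on its own input; the outcome of `P` is the output `-1`, the outcome
of `1 - P` is the output `1`. -/
inductive QuantumSteps (X : Type u) (Y : Type v) : ℕ → ℕ → Type (max u v)
  | aliceOutput {a b : ℕ} (P : X → Matrix (Fin a) (Fin a) ℂ)
      (hP : ∀ x, IsStarProjection (P x)) : QuantumSteps X Y a b
  | bobOutput {a b : ℕ} (P : Y → Matrix (Fin b) (Fin b) ℂ)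
      (hP : ∀ y, IsStarProjection (P y)) : QuantumSteps X Y a b
  | aliceSends {a b : ℕ} (a' : ℕ) (U : X → Matrix (Fin a' × Fin 2) (Fin a) ℂ)
      (hU : ∀ x, (U x)ᴴ * U x = 1) (next : QuantumSteps X Y a' (b * 2)) : QuantumSteps X Y a b
  | bobSends {a b : ℕ} (b' : ℕ) (V : Y → Matrix (Fin b' × Fin 2) (Fin b) ℂ)
      (hV : ∀ y, (V y)ᴴ * V y = 1) (next : QuantumSteps X Y (a * 2) b') : QuantumSteps X Y a b

namespace QuantumSteps

variable {X : Type u} {Y : Type v}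

/-- The last qubit of Alice's register is moved to the end of Bob's register. -/
def qubitToBob {a b : ℕ} (φ : Matrix (Fin a × Fin 2) (Fin b) ℂ) :
    Matrix (Fin a) (Fin (b * 2)) ℂ :=
  Matrix.of fun i j => φ (i, (finProdFinEquiv.symm j).2) (finProdFinEquiv.symm j).1

/-- The last qubit of Bob's register is moved to the end of Alice's register. -/
def qubitToAlice {a b : ℕ} (φ : Matrix (Fin a) (Fin b × Fin 2) ℂ) :
    Matrix (Fin (a * 2)) (Fin b) ℂ :=
  Matrix.of fun i j => φ (finProdFinEquiv.symm i).1 (j, (finProdFinEquiv.symm i).2)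

/-- The number of qubits exchanged. -/
def cost : {a b : ℕ} → QuantumSteps X Y a b → ℕ
  | _, _, aliceOutput _ _ => 0
  | _, _, bobOutput _ _ => 0
  | _, _, aliceSends _ _ _ next => next.cost + 1
  | _, _, bobSends _ _ _ next => next.cost + 1

/-- The probability of the output `-1` on the inputs `x`, `y`, started in the state `ψ`. -/
noncomputable def probNegOne : {a b : ℕ} → QuantumSteps X Y a b → X → Y →
    Matrix (Fin a) (Fin b) ℂ → ℝ
  | _, _, aliceOutput P _, x, _, ψ => ∑ i, ∑ j, ‖(P x * ψ) i j‖ ^ 2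
  | _, _, bobOutput P _, _, y, ψ => ∑ i, ∑ j, ‖(ψ * (P y)ᵀ) i j‖ ^ 2
  | _, _, aliceSends _ U _ next, x, y, ψ =>
      next.probNegOne x y (qubitToBob (U x * ψ))
  | _, _, bobSends _ V _ next, x, y, ψ =>
      next.probNegOne x y (qubitToAlice (ψ * (V y)ᵀ))

end QuantumSteps

/-- A two-party quantum protocol with arbitrary prior entanglement: the parties share an
input-independent unit vector of `ℂ^a ⊗ ℂ^b`, for any dimensions `a`, `b`, and then communicate.
(Private ancillas can be part of this vector.) -/
structure QuantumProtocol (X : Type u) (Y : Type v) where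
  /-- The initial dimension of Alice's register. -/
  a : ℕ
  /-- The initial dimension of Bob's register. -/
  b : ℕ
  /-- The shared initial state. -/
  shared : Matrix (Fin a) (Fin b) ℂ
  /-- The initial state is a unit vector. -/
  shared_norm : ∑ i, ∑ j, ‖shared i j‖ ^ 2 = 1
  /-- The communication and the final measurement. -/
  steps : QuantumSteps X Y a b

namespace QuantumProtocol

variable {X : Type u} {Y : Type v}

/-- The total number of qubits exchanged. -/
def cost (p : QuantumProtocol X Y) : ℕ := p.steps.cost

/-- The probability that the protocol outputs `o` on the inputs `x`, `y`. -/
noncomputable def outputProb (p : QuantumProtocol X Y) (x : X) (y : Y) (o : ℤˣ) : ℝ :=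
  if o = -1 then p.steps.probNegOne x y p.shared else 1 - p.steps.probNegOne x y p.shared

/-- `p` is an `ε`-error protocol for the partial Boolean function `f`, whose values are `-1`, `1`
and `*` (here `none`): on every input in the domain of `f`, it outputs the correct value with
probability at least `1 - ε`. -/
def Computes (p : QuantumProtocol X Y) (ε : ℝ) (f : X → Y → Option ℤˣ) : Prop :=
  ∀ x y o, f x y = some o → 1 - ε ≤ p.outputProb x y o

end QuantumProtocol

/-- The `ε`-error quantum communication complexity `Q*_ε(f)` with prior entanglement: the least
cost of an `ε`-error quantum protocol for `f`. -/
noncomputable def quantumComplexity {X : Type u} {Y : Type v} (ε : ℝ) (f : X → Y → Option ℤˣ) :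
    ℕ∞ :=
  ⨅ (p : QuantumProtocol X Y) (_ : p.Computes ε f), (p.cost : ℕ∞)

open Classical in
/-- The rank versus determinant problem: `-1` if `rk (A + B) = r`, `1` if `det (A + B) = a`, and
undefined otherwise. (For `r < n` and `a ≠ 0` the two cases exclude each other.) -/
noncomputable def rankDet (F : Type u) [Field F] (n r : ℕ) (a : F)
    (A B : Matrix (Fin n) (Fin n) F) : Option ℤˣ :=
  if (A + B).rank = r then some (-1) else if (A + B).det = a then some 1 else none

/-! Write q for the size of the field and T for the cost of a protocol. The probability of output
`-1` is a sum of 4^T terms, each pairing a vector that depends on Alice's input with one that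
depends on Bob's, all of norm at most 1 (`exists_decomposition`). Hence a protocol correlates with a
kernel Φ(A + B) by at most 4^T times the spectral norm of the kernel times the number of matrices
(`norm_sum_mul_accept_le`). Characters diagonalise such a kernel, so its spectral norm is at most
the largest Fourier coefficient of Φ (`norm_sum_add_mul_le`). It remains to find a Φ with tiny
Fourier coefficients that still tells rank r from determinant a.

The witness Φ (`rankDetWitness`) is the uniform law on rank r minus a combination of the uniform
laws on the ranks t ≤ m, with m about r/2, and on determinant a. The weights are those of Lagrange
interpolation at q^(-r) from the nodes q^(-t), t in {0, …, m, n}, where determinant a plays the role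
of rank n. So Φ is orthogonal to q^(-j rk Z) for all j ≤ m + 1. This moment is the average of the
Fourier transform of Φ over products of an n × j and a j × n matrix. The transform is invariant
under SL_n × SL_n, so at ranks below n it depends on the rank alone, and induction on the rank makes
it vanish up to rank m + 1 (`matrixFourier_eq_zero_of_rank_le`).

At rank s ≥ m + 2, Cauchy–Schwarz bounds the coefficient of the law of rank t by O(q^(-ts/2)). Where
this is weak, for small t, the interpolation weight is small (`abs_interpWeight_le`); together they
give O(q^(-r/3 - r²/16)).

The promise controls the protocol on the support of Φ except at ranks at most m, whose total weight
is O(q^(-r/2)). This is negligible against the advantage q^(-r/3)/2 once r log q is large, and then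
4^T is at least of order q^(r²/16). If r log q is bounded, T ≥ 1 is enough. -/

section ContractionDecomposition

open scoped Matrix.Norms.L2Operator

/-! ### Contractions, and the decomposition of acceptance probabilities into product terms. -/

section Contractions

variable {l m n : Type*} [Fintype l] [Fintype m] [Fintype n]

lemma Matrix.l2_opNorm_le_one_of_conjTranspose_mul_self [DecidableEq n] {A : Matrix m n ℂ} {E : Matrix n n ℂ}
    (h : Aᴴ * A = E) (hE : ‖E‖ ≤ 1) : ‖A‖ ≤ 1 := by
  have h1 := Matrix.l2_opNorm_conjTranspose_mul_self A
  rw [h] at h1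
  nlinarith [norm_nonneg A]

lemma Matrix.l2_opNorm_one_le [DecidableEq n] : ‖(1 : Matrix n n ℂ)‖ ≤ 1 := by
  have h := Matrix.l2_opNorm_conjTranspose_mul_self (1 : Matrix n n ℂ)
  rw [Matrix.conjTranspose_one, one_mul] at h
  nlinarith [norm_nonneg (1 : Matrix n n ℂ)]

lemma Matrix.l2_opNorm_le_one_of_isometry [DecidableEq n] {A : Matrix m n ℂ} (h : Aᴴ * A = 1) : ‖A‖ ≤ 1 :=
  Matrix.l2_opNorm_le_one_of_conjTranspose_mul_self h Matrix.l2_opNorm_one_le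

lemma Matrix.l2_opNorm_le_one_of_coisometry [DecidableEq m] [DecidableEq n] {A : Matrix m n ℂ} (h : A * Aᴴ = 1) : ‖A‖ ≤ 1 := by
  rw [← Matrix.l2_opNorm_conjTranspose]
  exact Matrix.l2_opNorm_le_one_of_isometry (by rwa [Matrix.conjTranspose_conjTranspose])

lemma Matrix.l2_opNorm_le_one_of_projection [DecidableEq n] {A : Matrix n n ℂ} (h : Aᴴ * A = A) : ‖A‖ ≤ 1 := by
  have h1 := Matrix.l2_opNorm_conjTranspose_mul_self A
  rw [h] at h1
  nlinarith [norm_nonneg A]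

lemma Matrix.l2_opNorm_mul_le_one [DecidableEq m] [DecidableEq n] {A : Matrix l m ℂ} {B : Matrix m n ℂ} (hA : ‖A‖ ≤ 1)
    (hB : ‖B‖ ≤ 1) : ‖A * B‖ ≤ 1 :=
  (Matrix.l2_opNorm_mul A B).trans (mul_le_one₀ hA (norm_nonneg _) hB)

lemma Matrix.sum_norm_sq_mul_le [DecidableEq m] {A : Matrix l m ℂ} (hA : ‖A‖ ≤ 1) (B : Matrix m n ℂ) :
    ∑ i, ∑ j, ‖(A * B) i j‖ ^ 2 ≤ ∑ i, ∑ j, ‖B i j‖ ^ 2 := by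
  rw [Finset.sum_comm, Finset.sum_comm (f := fun i j => ‖B i j‖ ^ 2)]
  refine Finset.sum_le_sum fun j _ => ?_
  have h := Matrix.l2_opNorm_mulVec A (WithLp.toLp 2 (fun i => B i j))
  have h2 : ‖(EuclideanSpace.equiv l ℂ).symm (A *ᵥ (WithLp.toLp 2 (fun i => B i j)).ofLp)‖ ≤
      ‖(WithLp.toLp 2 (fun i => B i j) : EuclideanSpace ℂ m)‖ :=
    h.trans (mul_le_of_le_one_left (norm_nonneg _) hA)
  have h3 := pow_le_pow_left₀ (norm_nonneg _) h2 2
  rw [EuclideanSpace.norm_sq_eq, EuclideanSpace.norm_sq_eq] at h3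
  exact h3

lemma Matrix.sum_norm_sq_mul_le' [DecidableEq m] [DecidableEq n] {B : Matrix m n ℂ} (hB : ‖B‖ ≤ 1) (A : Matrix l m ℂ) :
    ∑ i, ∑ j, ‖(A * B) i j‖ ^ 2 ≤ ∑ i, ∑ j, ‖A i j‖ ^ 2 := by
  have h := Matrix.sum_norm_sq_mul_le (A := Bᴴ) (by rwa [Matrix.l2_opNorm_conjTranspose]) Aᴴ
  rw [← Matrix.conjTranspose_mul, Finset.sum_comm,
    Finset.sum_comm (f := fun i j => ‖Aᴴ i j‖ ^ 2)] at h
  simpa [Matrix.conjTranspose_apply] using h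

lemma Matrix.sum_norm_sq_eq_trace (A : Matrix m n ℂ) :
    ((∑ i, ∑ j, ‖A i j‖ ^ 2 : ℝ) : ℂ) = (Aᴴ * A).trace := by
  simp only [Matrix.trace, Matrix.diag_apply, Matrix.mul_apply, Matrix.conjTranspose_apply]
  rw [Finset.sum_comm]
  push_cast
  simp [Complex.conj_mul']

lemma Matrix.trace_conj_eq_sum (ψ : Matrix m n ℂ) (A : Matrix m m ℂ) (B : Matrix n n ℂ) :
    (ψᴴ * A * ψ * B).trace = ∑ k : m × n, (A * ψ) k.1 k.2 * (B * ψᴴ) k.2 k.1 := by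
  have h : (ψᴴ * A * ψ * B).trace = ((A * ψ) * (B * ψᴴ)).trace := by
    rw [Matrix.mul_assoc, Matrix.mul_assoc, Matrix.trace_mul_comm]
    simp only [Matrix.mul_assoc]
  rw [h, Fintype.sum_prod_type]
  rfl

end Contractions

namespace QuantumSteps

/-- The co-isometry `φ ↦ (1 ⊗ ⟨c|) φ`, where the register `b * 2` is `b ⊗ 2`. -/
def qubitBra (b : ℕ) (c : Fin 2) : Matrix (Fin b) (Fin (b * 2)) ℂ :=
  (1 : Matrix (Fin b × Fin 2) (Fin b × Fin 2) ℂ).submatrix (fun j => (j, c)) finProdFinEquiv.symm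

lemma norm_qubitBra_le (b : ℕ) (c : Fin 2) : ‖qubitBra b c‖ ≤ 1 := by
  refine Matrix.l2_opNorm_le_one_of_coisometry ?_
  rw [qubitBra, Matrix.conjTranspose_submatrix, Matrix.submatrix_mul_equiv,
    Matrix.conjTranspose_one, one_mul]
  ext i j
  simp [Matrix.one_apply]

/-- The block of rows of `U` with last qubit in the basis state `c`. -/
def rowBlock {a' a : ℕ} (U : Matrix (Fin a' × Fin 2) (Fin a) ℂ) (c : Fin 2) :
    Matrix (Fin a') (Fin a) ℂ :=
  U.submatrix (fun i => (i, c)) id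

lemma norm_rowBlock_le {a' a : ℕ} {U : Matrix (Fin a' × Fin 2) (Fin a) ℂ} (hU : ‖U‖ ≤ 1)
    (c : Fin 2) : ‖rowBlock U c‖ ≤ 1 := by
  have h : rowBlock U c =
      (1 : Matrix (Fin a' × Fin 2) (Fin a' × Fin 2) ℂ).submatrix (fun i => (i, c)) id * U := by
    ext i j
    simp [rowBlock, Matrix.mul_apply, Matrix.one_apply]
  rw [h]
  refine Matrix.l2_opNorm_mul_le_one (Matrix.l2_opNorm_le_one_of_coisometry ?_) hU
  ext i j
  simp [Matrix.mul_apply, Matrix.one_apply]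

/-- Expanding the sent qubit in its basis states c, Alice applies the block of `U` ending in c and
Bob adjoins |c⟩ to his register. Each summand is thus a product of one operator per party. -/
lemma qubitToBob_mul {a' a b : ℕ} (U : Matrix (Fin a' × Fin 2) (Fin a) ℂ)
    (ψ : Matrix (Fin a) (Fin b) ℂ) :
    qubitToBob (U * ψ) = ∑ c, rowBlock U c * ψ * qubitBra b c := by
  ext i j
  obtain ⟨⟨k, c⟩, rfl⟩ := finProdFinEquiv.surjective j
  simp only [qubitToBob, Matrix.of_apply, Equiv.symm_apply_apply, Matrix.sum_apply]
  rw [Finset.sum_eq_single c]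
  · rw [Matrix.mul_apply (M := rowBlock U c * ψ), Finset.sum_eq_single k]
    · have h : qubitBra b c k (finProdFinEquiv (k, c)) = 1 := by
        rw [qubitBra, Matrix.submatrix_apply, Equiv.symm_apply_apply, Matrix.one_apply_eq]
      rw [h, mul_one]
      rfl
    · intro k' _ hk
      simp [qubitBra, hk]
    · simp
  · intro c' _ hc
    rw [Matrix.mul_apply]
    refine Finset.sum_eq_zero fun k' _ => ?_
    simp [qubitBra, hc]
  · simp

lemma qubitToAlice_eq {a b : ℕ} (φ : Matrix (Fin a) (Fin b × Fin 2) ℂ) :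
    qubitToAlice φ = (qubitToBob φᵀ)ᵀ := rfl

lemma qubitToAlice_mul {a b' b : ℕ} (V : Matrix (Fin b' × Fin 2) (Fin b) ℂ)
    (ψ : Matrix (Fin a) (Fin b) ℂ) :
    qubitToAlice (ψ * Vᵀ) = ∑ c, (qubitBra a c)ᴴ * ψ * (rowBlock V c)ᵀ := by
  rw [qubitToAlice_eq, Matrix.transpose_mul, Matrix.transpose_transpose, qubitToBob_mul,
    Matrix.transpose_sum]
  refine Finset.sum_congr rfl fun c _ => ?_
  have h : (qubitBra a c)ᴴ = (qubitBra a c)ᵀ := by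
    ext i j
    simp [qubitBra, Matrix.one_apply, apply_ite]
  rw [h, Matrix.transpose_mul, Matrix.transpose_mul, Matrix.transpose_transpose, Matrix.mul_assoc]

end QuantumSteps

lemma Matrix.l2_opNorm_transpose_le_one {m n : Type*} [Fintype m] [Fintype n] [DecidableEq m]
    [DecidableEq n] {A : Matrix m n ℂ} (hA : Aᴴ * A = 1) : ‖Aᵀ‖ ≤ 1 := by
  refine Matrix.l2_opNorm_le_one_of_coisometry ?_
  have h : (Aᵀ)ᴴ = (Aᴴ)ᵀ := rfl
  rw [h, ← Matrix.transpose_mul, hA, Matrix.transpose_one]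

lemma Matrix.transpose_projection {n : Type*} [Fintype n] {P : Matrix n n ℂ}
    (hP : IsStarProjection P) : (Pᵀ)ᴴ * Pᵀ = Pᵀ := by
  have h1 : Pᴴ = P := hP.isSelfAdjoint
  have h2 : P * P = P := hP.isIdempotentElem
  have h : (Pᵀ)ᴴ = (Pᴴ)ᵀ := rfl
  rw [h, h1, ← Matrix.transpose_mul, h2]

namespace QuantumSteps

variable {X : Type u} {Y : Type v}

lemma probNegOne_nonneg {a b : ℕ} (S : QuantumSteps X Y a b) (x : X) (y : Y)
    (ψ : Matrix (Fin a) (Fin b) ℂ) : 0 ≤ S.probNegOne x y ψ := by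
  induction S with
  | aliceOutput P hP => simp only [probNegOne]; positivity
  | bobOutput P hP => simp only [probNegOne]; positivity
  | aliceSends a' U hU next ih => exact ih _
  | bobSends b' V hV next ih => exact ih _

lemma sum_norm_sq_qubitToBob {a b : ℕ} (φ : Matrix (Fin a × Fin 2) (Fin b) ℂ) :
    ∑ i, ∑ j, ‖qubitToBob φ i j‖ ^ 2 = ∑ i, ∑ j, ‖φ i j‖ ^ 2 := by
  simp only [qubitToBob, Matrix.of_apply]
  rw [Fintype.sum_prod_type]
  refine Finset.sum_congr rfl fun i _ => ?_
  rw [Equiv.sum_comp finProdFinEquiv.symm (fun p : Fin b × Fin 2 => ‖φ (i, p.2) p.1‖ ^ 2),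
    Fintype.sum_prod_type, Finset.sum_comm]

lemma sum_norm_sq_qubitToAlice {a b : ℕ} (φ : Matrix (Fin a) (Fin b × Fin 2) ℂ) :
    ∑ i, ∑ j, ‖qubitToAlice φ i j‖ ^ 2 = ∑ i, ∑ j, ‖φ i j‖ ^ 2 := by
  rw [Finset.sum_comm, Finset.sum_comm (f := fun i j => ‖φ i j‖ ^ 2)]
  exact sum_norm_sq_qubitToBob φᵀ

lemma probNegOne_le {a b : ℕ} (S : QuantumSteps X Y a b) (x : X) (y : Y)
    (ψ : Matrix (Fin a) (Fin b) ℂ) : S.probNegOne x y ψ ≤ ∑ i, ∑ j, ‖ψ i j‖ ^ 2 := by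
  induction S with
  | aliceOutput P hP =>
    refine Matrix.sum_norm_sq_mul_le (Matrix.l2_opNorm_le_one_of_projection ?_) ψ
    have h1 : (P x)ᴴ = P x := (hP x).isSelfAdjoint
    rw [h1]
    exact (hP x).isIdempotentElem
  | bobOutput P hP =>
    exact Matrix.sum_norm_sq_mul_le'
      (Matrix.l2_opNorm_le_one_of_projection (Matrix.transpose_projection (hP y))) ψ
  | aliceSends a' U hU next ih =>
    refine (ih _).trans ?_
    rw [sum_norm_sq_qubitToBob]
    exact Matrix.sum_norm_sq_mul_le (Matrix.l2_opNorm_le_one_of_isometry (hU x)) ψ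
  | bobSends b' V hV next ih =>
    refine (ih _).trans ?_
    rw [sum_norm_sq_qubitToAlice]
    exact Matrix.sum_norm_sq_mul_le' (Matrix.l2_opNorm_transpose_le_one (hV y)) ψ

/-- The probability of the output `-1` after `T` qubits is a sum of `4 ^ T` terms
`tr (ψᴴ A(x) ψ B(y))` with contractions `A(x)` and `B(y)`. -/
theorem exists_decomposition {a b : ℕ} (S : QuantumSteps X Y a b) :
    ∃ (ι : Type) (_ : Fintype ι) (A : ι → X → Matrix (Fin a) (Fin a) ℂ)
      (B : ι → Y → Matrix (Fin b) (Fin b) ℂ),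
      Fintype.card ι = 4 ^ S.cost ∧ (∀ i x, ‖A i x‖ ≤ 1) ∧ (∀ i y, ‖B i y‖ ≤ 1) ∧
      ∀ x y ψ, (S.probNegOne x y ψ : ℂ) = ∑ i, (ψᴴ * A i x * ψ * B i y).trace := by
  induction S with
  | aliceOutput P hP =>
    have h1 : ∀ x, (P x)ᴴ = P x := fun x => (hP x).isSelfAdjoint
    have h2 : ∀ x, P x * P x = P x := fun x => (hP x).isIdempotentElem
    refine ⟨Unit, inferInstance, fun _ x => P x, fun _ _ => 1, by simp [cost], fun _ x => ?_,
      fun _ _ => Matrix.l2_opNorm_one_le, fun x y ψ => ?_⟩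
    · exact Matrix.l2_opNorm_le_one_of_projection (by rw [h1, h2])
    · simp only [probNegOne]
      rw [Matrix.sum_norm_sq_eq_trace, Matrix.conjTranspose_mul, h1]
      simp only [Finset.univ_unique, Finset.sum_const, Finset.card_singleton, one_smul, mul_one]
      rw [Matrix.mul_assoc, ← Matrix.mul_assoc (P x), h2, Matrix.mul_assoc]
  | bobOutput P hP =>
    refine ⟨Unit, inferInstance, fun _ _ => 1, fun _ y => (P y)ᵀ, by simp [cost],
      fun _ _ => Matrix.l2_opNorm_one_le,
      fun _ y => Matrix.l2_opNorm_le_one_of_projection (Matrix.transpose_projection (hP y)),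
      fun x y ψ => ?_⟩
    simp only [probNegOne]
    rw [Matrix.sum_norm_sq_eq_trace, Matrix.conjTranspose_mul]
    simp only [Finset.univ_unique, Finset.sum_const, Finset.card_singleton, one_smul]
    have h1 : (P y)ᴴ = P y := (hP y).isSelfAdjoint
    have h2 : P y * P y = P y := (hP y).isIdempotentElem
    have h : ((P y)ᵀ)ᴴ = ((P y)ᴴ)ᵀ := rfl
    rw [Matrix.mul_assoc, Matrix.trace_mul_comm, h, h1, Matrix.mul_assoc ψᴴ, Matrix.mul_assoc ψᴴ,
      Matrix.mul_assoc ψ, ← Matrix.transpose_mul, h2]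
    simp only [Matrix.mul_assoc, Matrix.one_mul]
  | @aliceSends a b a' U hU next ih =>
    obtain ⟨ι, _, A, B, hc, hA, hB, h⟩ := ih
    -- The sent qubit is expanded once in the state and once in its adjoint. The two basis labels
    -- are independent, which is the factor 4 per qubit.
    refine ⟨ι × Fin 2 × Fin 2, inferInstance,
      fun i x => (rowBlock (U x) i.2.2)ᴴ * A i.1 x * rowBlock (U x) i.2.1,
      fun i y => qubitBra b i.2.1 * B i.1 y * (qubitBra b i.2.2)ᴴ, ?_, fun i x => ?_,
      fun i y => ?_, fun x y ψ => ?_⟩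
    · simp [cost, hc, pow_succ]
    · have hUx := Matrix.l2_opNorm_le_one_of_isometry (hU x)
      refine Matrix.l2_opNorm_mul_le_one (Matrix.l2_opNorm_mul_le_one ?_ (hA _ _))
        (norm_rowBlock_le hUx _)
      rw [Matrix.l2_opNorm_conjTranspose]
      exact norm_rowBlock_le hUx _
    · refine Matrix.l2_opNorm_mul_le_one (Matrix.l2_opNorm_mul_le_one (norm_qubitBra_le _ _)
        (hB _ _)) ?_
      rw [Matrix.l2_opNorm_conjTranspose]
      exact norm_qubitBra_le _ _
    · simp only [probNegOne]
      rw [h, Fintype.sum_prod_type]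
      refine Finset.sum_congr rfl fun i _ => ?_
      rw [qubitToBob_mul, Fintype.sum_prod_type, Matrix.conjTranspose_sum]
      simp only [Matrix.sum_mul, Matrix.mul_sum, Matrix.trace_sum]
      refine Finset.sum_congr rfl fun c _ => Finset.sum_congr rfl fun c' _ => ?_
      rw [Matrix.conjTranspose_mul, Matrix.conjTranspose_mul]
      simp only [Matrix.mul_assoc]
      rw [Matrix.trace_mul_comm]
      simp only [Matrix.mul_assoc]
  | @bobSends a b b' V hV next ih =>
    obtain ⟨ι, _, A, B, hc, hA, hB, h⟩ := ih
    have hV' : ∀ y c, ‖(rowBlock (V y) c)ᵀ‖ ≤ 1 := fun y c => by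
      have hVy := Matrix.l2_opNorm_transpose_le_one (hV y)
      have h1 : (rowBlock (V y) c)ᵀ = (V y)ᵀ *
          ((1 : Matrix (Fin b' × Fin 2) (Fin b' × Fin 2) ℂ).submatrix id (fun i => (i, c))) := by
        ext i j
        simp [rowBlock, Matrix.mul_apply, Matrix.one_apply]
      rw [h1]
      refine Matrix.l2_opNorm_mul_le_one hVy (Matrix.l2_opNorm_le_one_of_isometry ?_)
      ext i j
      simp [Matrix.mul_apply, Matrix.one_apply]
    refine ⟨ι × Fin 2 × Fin 2, inferInstance,
      fun i x => qubitBra a i.2.2 * A i.1 x * (qubitBra a i.2.1)ᴴ,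
      fun i y => (rowBlock (V y) i.2.1)ᵀ * B i.1 y * ((rowBlock (V y) i.2.2)ᵀ)ᴴ, ?_, fun i x => ?_,
      fun i y => ?_, fun x y ψ => ?_⟩
    · simp [cost, hc, pow_succ]
    · refine Matrix.l2_opNorm_mul_le_one (Matrix.l2_opNorm_mul_le_one (norm_qubitBra_le _ _)
        (hA _ _)) ?_
      rw [Matrix.l2_opNorm_conjTranspose]
      exact norm_qubitBra_le _ _
    · refine Matrix.l2_opNorm_mul_le_one (Matrix.l2_opNorm_mul_le_one (hV' _ _) (hB _ _)) ?_
      rw [Matrix.l2_opNorm_conjTranspose]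
      exact hV' _ _
    · simp only [probNegOne]
      rw [h, Fintype.sum_prod_type]
      refine Finset.sum_congr rfl fun i _ => ?_
      rw [qubitToAlice_mul, Fintype.sum_prod_type, Matrix.conjTranspose_sum]
      simp only [Matrix.sum_mul, Matrix.mul_sum, Matrix.trace_sum]
      refine Finset.sum_congr rfl fun c _ => Finset.sum_congr rfl fun c' _ => ?_
      rw [Matrix.conjTranspose_mul, Matrix.conjTranspose_mul, Matrix.conjTranspose_conjTranspose]
      simp only [Matrix.mul_assoc]
      rw [Matrix.trace_mul_comm]
      simp only [Matrix.mul_assoc]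

end QuantumSteps

/-- A bound for a bilinear form on pairs of vectors follows coordinatewise from the bound for
scalars. -/
lemma norm_sum_mul_inner_le {X Y κ : Type*} [Fintype X] [Fintype Y] [Fintype κ]
    {K : X → Y → ℂ} {N : ℝ} (hN : 0 ≤ N)
    (hK : ∀ (f : X → ℂ) (g : Y → ℂ), ‖∑ x, ∑ y, K x y * (f x * g y)‖ ≤
      N * (√(∑ x, ‖f x‖ ^ 2) * √(∑ y, ‖g y‖ ^ 2)))
    (f : X → κ → ℂ) (g : Y → κ → ℂ) (hf : ∀ x, ∑ k, ‖f x k‖ ^ 2 ≤ 1)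
    (hg : ∀ y, ∑ k, ‖g y k‖ ^ 2 ≤ 1) :
    ‖∑ x, ∑ y, K x y * ∑ k, f x k * g y k‖ ≤
      N * (√(Fintype.card X) * √(Fintype.card Y)) := by
  have h1 : ∑ x, ∑ y, K x y * ∑ k, f x k * g y k =
      ∑ k, ∑ x, ∑ y, K x y * (f x k * g y k) := by
    simp only [Finset.mul_sum]
    rw [Finset.sum_comm]
    rw [Finset.sum_comm (s := (Finset.univ : Finset κ))]
    rw [Finset.sum_comm]
    exact Finset.sum_congr rfl fun x _ => Finset.sum_comm
  rw [h1]
  refine (norm_sum_le _ _).trans ((Finset.sum_le_sum fun k _ => hK _ _).trans ?_)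
  rw [← Finset.mul_sum]
  refine mul_le_mul_of_nonneg_left ?_ hN
  refine (Real.sum_sqrt_mul_sqrt_le _ (fun _ => by positivity) (fun _ => by positivity)).trans ?_
  rw [Finset.sum_comm, Finset.sum_comm (s := Finset.univ (α := κ))]
  gcongr
  · exact (Finset.sum_le_sum fun x _ => hf x).trans (by simp)
  · exact (Finset.sum_le_sum fun x _ => hg x).trans (by simp)

namespace QuantumProtocol

variable {X : Type u} {Y : Type v}

/-- The probability that `p` outputs `-1`. -/
noncomputable def accept (p : QuantumProtocol X Y) (x : X) (y : Y) : ℝ :=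
  p.steps.probNegOne x y p.shared

lemma accept_nonneg (p : QuantumProtocol X Y) (x : X) (y : Y) : 0 ≤ p.accept x y :=
  p.steps.probNegOne_nonneg x y _

lemma accept_le_one (p : QuantumProtocol X Y) (x : X) (y : Y) : p.accept x y ≤ 1 :=
  (p.steps.probNegOne_le x y _).trans_eq p.shared_norm

/-- The spectral lower bound: a protocol of cost `T` correlates with a matrix of spectral norm at
most `N` by at most `4 ^ T * N * √(|X| |Y|)`. -/
theorem norm_sum_mul_accept_le [Fintype X] [Fintype Y] (p : QuantumProtocol X Y)
    {K : X → Y → ℂ} {N : ℝ} (hN : 0 ≤ N)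
    (hK : ∀ (f : X → ℂ) (g : Y → ℂ), ‖∑ x, ∑ y, K x y * (f x * g y)‖ ≤
      N * (√(∑ x, ‖f x‖ ^ 2) * √(∑ y, ‖g y‖ ^ 2))) :
    ‖∑ x, ∑ y, K x y * (p.accept x y : ℂ)‖ ≤
      4 ^ p.cost * (N * (√(Fintype.card X) * √(Fintype.card Y))) := by
  obtain ⟨ι, _, A, B, hc, hA, hB, h⟩ := p.steps.exists_decomposition
  have h1 : ∑ x, ∑ y, K x y * (p.accept x y : ℂ) = ∑ i, ∑ x, ∑ y, K x y *
      ∑ k : Fin p.a × Fin p.b, (A i x * p.shared) k.1 k.2 * (B i y * p.sharedᴴ) k.2 k.1 := by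
    rw [Finset.sum_comm (s := (Finset.univ : Finset ι))]
    refine Finset.sum_congr rfl fun x _ => ?_
    rw [Finset.sum_comm (s := (Finset.univ : Finset ι))]
    refine Finset.sum_congr rfl fun y _ => ?_
    rw [accept, h, Finset.mul_sum]
    refine Finset.sum_congr rfl fun i _ => ?_
    rw [Matrix.trace_conj_eq_sum]
  rw [h1]
  refine (norm_sum_le _ _).trans ?_
  have h2 : ∀ i ∈ (Finset.univ : Finset ι), ‖∑ x, ∑ y, K x y *
      ∑ k : Fin p.a × Fin p.b, (A i x * p.shared) k.1 k.2 * (B i y * p.sharedᴴ) k.2 k.1‖ ≤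
      N * (√(Fintype.card X) * √(Fintype.card Y)) := by
    intro i _
    -- The paired vectors are the entries of A(x)ψ and of B(y)ψᴴ; contractions do not increase the
    -- norm of the shared state ψ, which is 1.
    have hf : ∀ x, ∑ k : Fin p.a × Fin p.b, ‖(A i x * p.shared) k.1 k.2‖ ^ 2 ≤ 1 := fun x => by
      have h2 := Matrix.sum_norm_sq_mul_le (hA i x) p.shared
      rw [p.shared_norm] at h2
      rwa [Fintype.sum_prod_type]
    have hg : ∀ y, ∑ k : Fin p.a × Fin p.b, ‖(B i y * p.sharedᴴ) k.2 k.1‖ ^ 2 ≤ 1 := fun y => by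
      have h2 := Matrix.sum_norm_sq_mul_le (hB i y) p.sharedᴴ
      have h3 : ∑ j, ∑ i, ‖p.sharedᴴ j i‖ ^ 2 = 1 := by
        rw [Finset.sum_comm, ← p.shared_norm]
        simp only [Matrix.conjTranspose_apply, norm_star]
      rw [h3] at h2
      rwa [Fintype.sum_prod_type, Finset.sum_comm]
    exact norm_sum_mul_inner_le (K := K) (κ := Fin p.a × Fin p.b) hN hK
      (fun x k => (A i x * p.shared) k.1 k.2) (fun y k => (B i y * p.sharedᴴ) k.2 k.1) hf hg
  refine (Finset.sum_le_sum h2).trans_eq ?_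
  rw [Finset.sum_const, Finset.card_univ, hc, nsmul_eq_mul]
  push_cast
  rfl

end QuantumProtocol

end ContractionDecomposition

/-! ### Fourier analysis on matrices over a finite field. -/

section MatrixCharacters

variable {F : Type u} [Field F] [Fintype F]

lemma exists_isPrimitive_addChar_complex (F : Type u) [Field F] [Fintype F] :
    ∃ ψ : AddChar F ℂ, ψ.IsPrimitive := by
  obtain ⟨ψ, hψ⟩ := (AddChar.exists_apply_ne_zero (α := F) (a := 1)).2 one_ne_zero
  exact ⟨ψ, AddChar.IsPrimitive.of_ne_one (AddChar.ne_one_iff.2 ⟨1, hψ⟩)⟩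

variable {m n : Type*} [Fintype m] [Fintype n] [DecidableEq m] [DecidableEq n] {ψ : AddChar F ℂ}

lemma sum_addChar_trace_mul (hψ : ψ.IsPrimitive) (A : Matrix m n F) [Decidable (A = 0)] :
    ∑ Q : Matrix n m F, ψ (Q * A).trace =
      if A = 0 then (Fintype.card (Matrix n m F) : ℂ) else 0 := by
  split_ifs with h
  · simp [h]
  · obtain ⟨i, j, hij⟩ : ∃ i j, A i j ≠ 0 := by
      by_contra! hc
      exact h (Matrix.ext hc)
    obtain ⟨c, hc⟩ := AddChar.ne_one_iff.1 (hψ hij)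
    rw [AddChar.mulShift_apply] at hc
    -- If A has a nonzero entry, Q ↦ ψ(tr(QA)) is a nontrivial character, as a single-entry matrix Q
    -- shows, so it sums to zero.
    let χ : AddChar (Matrix n m F) ℂ := ψ.compAddMonoidHom
      { toFun := fun Q => (Q * A).trace
        map_zero' := by simp
        map_add' := fun P Q => by rw [Matrix.add_mul, Matrix.trace_add] }
    refine AddChar.sum_eq_zero_of_ne_one (ψ := χ) (AddChar.ne_one_iff.2 ⟨Matrix.single j i c, ?_⟩)
    change ψ (Matrix.single j i c * A).trace ≠ 1
    rwa [Matrix.trace_single_mul, smul_eq_mul, mul_comm]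

/-- The Fourier transform of a function on square matrices. -/
noncomputable def matrixFourier (ψ : AddChar F ℂ) (f : Matrix n n F → ℂ) (M : Matrix n n F) : ℂ :=
  ∑ Z, f Z * ψ (Z * M).trace

lemma matrixFourier_inversion (hψ : ψ.IsPrimitive) (f : Matrix n n F → ℂ) (Z : Matrix n n F) :
    ∑ M, matrixFourier ψ f M * ψ (-(Z * M).trace) = Fintype.card (Matrix n n F) * f Z := by
  classical
  simp only [matrixFourier, Finset.sum_mul]
  rw [Finset.sum_comm]
  have h : ∀ W, ∑ M, f W * ψ (W * M).trace * ψ (-(Z * M).trace) =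
      if W = Z then (Fintype.card (Matrix n n F) : ℂ) * f Z else 0 := by
    intro W
    have h1 : ∀ M, f W * ψ (W * M).trace * ψ (-(Z * M).trace) =
        f W * ψ (M * (W - Z)).trace := by
      intro M
      rw [mul_assoc, ← AddChar.map_add_eq_mul, ← sub_eq_add_neg, ← Matrix.trace_sub,
        ← Matrix.sub_mul, Matrix.trace_mul_comm]
    simp only [h1]
    rw [← Finset.mul_sum, sum_addChar_trace_mul hψ]
    simp only [sub_eq_zero]
    split_ifs with h2
    · rw [h2, mul_comm]
    · simp
  simp [h]

lemma sum_norm_sq_matrixFourier (hψ : ψ.IsPrimitive) (f : Matrix n n F → ℂ) :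
    ∑ M, ‖matrixFourier ψ f M‖ ^ 2 = Fintype.card (Matrix n n F) * ∑ Z, ‖f Z‖ ^ 2 := by
  have h : ((∑ M, ‖matrixFourier ψ f M‖ ^ 2 : ℝ) : ℂ) =
      ((Fintype.card (Matrix n n F) * ∑ Z, ‖f Z‖ ^ 2 : ℝ) : ℂ) := by
    push_cast
    simp only [← Complex.mul_conj']
    have h1 : ∀ M, matrixFourier ψ f M * (starRingEnd ℂ) (matrixFourier ψ f M) =
        ∑ Z, (starRingEnd ℂ) (f Z) * (matrixFourier ψ f M * ψ (-(Z * M).trace)) := by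
      intro M
      simp only [matrixFourier]
      rw [map_sum, Finset.mul_sum]
      refine Finset.sum_congr rfl fun Z _ => ?_
      rw [map_mul, AddChar.map_neg_eq_conj]
      ring
    simp only [h1]
    rw [Finset.sum_comm]
    simp only [← Finset.mul_sum, matrixFourier_inversion hψ]
    rw [Finset.mul_sum]
    refine Finset.sum_congr rfl fun Z _ => ?_
    ring
  exact_mod_cast h

/-- The spectral norm of `(A, B) ↦ f (A + B)` is at most the largest Fourier coefficient of `f`. -/
theorem norm_sum_add_mul_le (hψ : ψ.IsPrimitive) {Φ : Matrix n n F → ℂ} {N : ℝ} (hN0 : 0 ≤ N)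
    (hN : ∀ M, ‖matrixFourier ψ Φ M‖ ≤ N) (f g : Matrix n n F → ℂ) :
    ‖∑ x, ∑ y, Φ (x + y) * (f x * g y)‖ ≤ N * (√(∑ x, ‖f x‖ ^ 2) * √(∑ y, ‖g y‖ ^ 2)) := by
  set G : ℝ := (Fintype.card (Matrix n n F) : ℝ) with hG
  have hG0 : 0 < G := by
    rw [hG]
    exact_mod_cast Fintype.card_pos
  -- Fourier inversion of Φ turns the form into a diagonal one; Cauchy–Schwarz and Plancherel for f
  -- and g then finish.
  have h1 : (G : ℂ) * ∑ x, ∑ y, Φ (x + y) * (f x * g y) =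
      ∑ M, matrixFourier ψ Φ M * (matrixFourier ψ f (-M) * matrixFourier ψ g (-M)) := by
    have h2 : ∀ M, matrixFourier ψ Φ M * (matrixFourier ψ f (-M) * matrixFourier ψ g (-M)) =
        ∑ x, ∑ y, (f x * g y) * (matrixFourier ψ Φ M * ψ (-((x + y) * M).trace)) := by
      intro M
      rw [show matrixFourier ψ f (-M) = ∑ x, f x * ψ (x * -M).trace from rfl,
        show matrixFourier ψ g (-M) = ∑ y, g y * ψ (y * -M).trace from rfl, Finset.sum_mul_sum, Finset.mul_sum]
      refine Finset.sum_congr rfl fun x _ => ?_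
      rw [Finset.mul_sum]
      refine Finset.sum_congr rfl fun y _ => ?_
      rw [Matrix.add_mul, Matrix.trace_add, neg_add, AddChar.map_add_eq_mul]
      simp only [Matrix.mul_neg, Matrix.trace_neg]
      ring
    simp only [h2]
    symm
    rw [Finset.sum_comm, Finset.mul_sum]
    refine Finset.sum_congr rfl fun x _ => ?_
    rw [Finset.sum_comm, Finset.mul_sum]
    refine Finset.sum_congr rfl fun y _ => ?_
    rw [← Finset.mul_sum, matrixFourier_inversion hψ, hG]
    push_cast
    ring
  have h3 : G * ‖∑ x, ∑ y, Φ (x + y) * (f x * g y)‖ ≤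
      G * (N * (√(∑ x, ‖f x‖ ^ 2) * √(∑ y, ‖g y‖ ^ 2))) := by
    calc G * ‖∑ x, ∑ y, Φ (x + y) * (f x * g y)‖
        = ‖(G : ℂ) * ∑ x, ∑ y, Φ (x + y) * (f x * g y)‖ := by
          rw [norm_mul, Complex.norm_real, Real.norm_of_nonneg hG0.le]
      _ ≤ ∑ M, N * (‖matrixFourier ψ f (-M)‖ * ‖matrixFourier ψ g (-M)‖) := by
          rw [h1]
          refine (norm_sum_le _ _).trans (Finset.sum_le_sum fun M _ => ?_)
          rw [norm_mul, norm_mul]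
          exact mul_le_mul_of_nonneg_right (hN M) (by positivity)
      _ = N * ∑ M, ‖matrixFourier ψ f M‖ * ‖matrixFourier ψ g M‖ := by
          rw [← Finset.mul_sum]
          congr 1
          exact Equiv.sum_comp (Equiv.neg _)
            (fun M => ‖matrixFourier ψ f M‖ * ‖matrixFourier ψ g M‖)
      _ ≤ N * (√(G * ∑ x, ‖f x‖ ^ 2) * √(G * ∑ x, ‖g x‖ ^ 2)) := by
          refine mul_le_mul_of_nonneg_left ?_ hN0
          rw [hG, ← sum_norm_sq_matrixFourier hψ, ← sum_norm_sq_matrixFourier hψ]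
          exact Real.sum_mul_le_sqrt_mul_sqrt _ _ _
      _ = G * (N * (√(∑ x, ‖f x‖ ^ 2) * √(∑ y, ‖g y‖ ^ 2))) := by
          rw [Real.sqrt_mul hG0.le, Real.sqrt_mul hG0.le]
          have := Real.mul_self_sqrt hG0.le
          linear_combination (N * (√(∑ x, ‖f x‖ ^ 2) * √(∑ y, ‖g y‖ ^ 2))) * this
  exact le_of_mul_le_mul_left h3 hG0

lemma card_mul_eq_zero {m n k : ℕ} (M : Matrix (Fin m) (Fin n) F) :
    Fintype.card F ^ (M.rank * k) * {P : Matrix (Fin n) (Fin k) F | M * P = 0}.ncard =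
      Fintype.card F ^ (n * k) := by
  -- `M * P = 0` says that each of the k columns of P lies in the kernel of M.
  let e : {P : Matrix (Fin n) (Fin k) F // M * P = 0} ≃
      (Fin k → LinearMap.ker M.mulVecLin) :=
    { toFun := fun P j => ⟨P.1.col j, by
        rw [LinearMap.mem_ker, Matrix.mulVecLin_apply]
        ext i
        exact congr_fun (congr_fun P.2 i) j⟩
      invFun := fun v => ⟨Matrix.of fun i j => (v j).1 i, by
        ext i j
        have := (v j).2
        rw [LinearMap.mem_ker, Matrix.mulVecLin_apply] at this
        exact congr_fun this i⟩
      left_inv := fun P => rfl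
      right_inv := fun v => rfl }
  have h1 : {P : Matrix (Fin n) (Fin k) F | M * P = 0}.ncard =
      (Fintype.card F ^ Module.finrank F (LinearMap.ker M.mulVecLin)) ^ k := by
    have h0 : {P : Matrix (Fin n) (Fin k) F | M * P = 0}.ncard =
        Nat.card (Fin k → LinearMap.ker M.mulVecLin) := Nat.card_congr e
    rw [h0, Nat.card_fun, Nat.card_fin, Module.natCard_eq_pow_finrank (K := F),
      Nat.card_eq_fintype_card]
  have h2 := M.mulVecLin.finrank_range_add_finrank_ker
  rw [Module.finrank_fin_fun] at h2
  rw [h1, ← pow_mul, ← pow_add, ← add_mul]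
  congr 2

/-- The proportion of the matrices `P` with `k` columns such that `M * P = 0`. -/
lemma card_mul_eq_zero_real {m n k : ℕ} (M : Matrix (Fin m) (Fin n) F) :
    ({P : Matrix (Fin n) (Fin k) F | M * P = 0}.ncard : ℝ) =
      (Fintype.card F : ℝ) ^ (n * k) * ((Fintype.card F : ℝ)⁻¹ ^ k) ^ M.rank := by
  have h : (Fintype.card F : ℝ) ^ (M.rank * k) *
      ({P : Matrix (Fin n) (Fin k) F | M * P = 0}.ncard : ℝ) =
      (Fintype.card F : ℝ) ^ (n * k) := by exact_mod_cast card_mul_eq_zero M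
  have hq : (Fintype.card F : ℝ) ≠ 0 := by exact_mod_cast Fintype.card_ne_zero
  rw [← h, ← pow_mul, inv_pow, mul_comm k]
  field_simp

lemma card_matrix_real {F : Type u} [Fintype F] (m n : ℕ) :
    (Fintype.card (Matrix (Fin m) (Fin n) F) : ℝ) = (Fintype.card F : ℝ) ^ (m * n) := by
  rw [← Nat.card_eq_fintype_card, Nat.card_congr Matrix.of.symm]
  simp [← pow_mul, mul_comm]

/-- The average of `ψ (tr (Z L R))` over all `L` and `R` with inner dimension `j` is
`q ^ (-j rk Z)`. -/
lemma sum_addChar_trace_mul_mul (hψ : ψ.IsPrimitive) {n j : ℕ} (Z : Matrix (Fin n) (Fin n) F) :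
    ∑ L : Matrix (Fin n) (Fin j) F, ∑ R : Matrix (Fin j) (Fin n) F, ψ (Z * (L * R)).trace =
      (((Fintype.card F : ℝ) ^ (j * n) * ((Fintype.card F : ℝ) ^ (n * j) *
        ((Fintype.card F : ℝ)⁻¹ ^ j) ^ Z.rank) : ℝ) : ℂ) := by
  classical
  have h : ∀ L : Matrix (Fin n) (Fin j) F,
      ∑ R : Matrix (Fin j) (Fin n) F, ψ (Z * (L * R)).trace =
      if Z * L = 0 then (((Fintype.card F : ℝ) ^ (j * n) : ℝ) : ℂ) else 0 := by
    intro L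
    rw [← card_matrix_real, Complex.ofReal_natCast, ← sum_addChar_trace_mul hψ]
    refine Finset.sum_congr rfl fun R _ => ?_
    rw [← Matrix.mul_assoc, Matrix.trace_mul_comm]
  simp only [h]
  rw [← Finset.sum_filter, Finset.sum_const, nsmul_eq_mul, ← card_mul_eq_zero_real,
    ← Set.ncard_coe_finset]
  simp
  ring

/-- A bilinear Cauchy–Schwarz bound for exponential sums over products of matrices. -/
lemma norm_sum_addChar_trace_mul_sq_le (hψ : ψ.IsPrimitive) {n t : ℕ}
    (S : Finset (Matrix (Fin n) (Fin t) F)) (R : Finset (Matrix (Fin t) (Fin n) F))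
    (M : Matrix (Fin n) (Fin n) F) :
    ‖∑ P ∈ S, ∑ Q ∈ R, ψ (P * Q * M).trace‖ ^ 2 ≤
      S.card * R.card * ((Fintype.card F : ℝ) ^ (n * t)) ^ 2 *
        ((Fintype.card F : ℝ)⁻¹ ^ t) ^ M.rank := by
  classical
  have htr : ∀ (P : Matrix (Fin n) (Fin t) F) (Q : Matrix (Fin t) (Fin n) F),
      (P * Q * M).trace = (Q * (M * P)).trace := fun P Q => by
    rw [Matrix.mul_assoc, Matrix.trace_mul_comm, Matrix.mul_assoc]
  simp only [htr]
  rw [Finset.sum_comm]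
  -- Cauchy–Schwarz in Q, after which the sum of squares is extended from R to all Q. Orthogonality
  -- then leaves only the pairs with M(P - P') = 0, and for fixed P these inject into the solutions
  -- of MP' = 0.
  have h1 : ‖∑ Q ∈ R, ∑ P ∈ S, ψ (Q * (M * P)).trace‖ ^ 2 ≤
      R.card * ∑ Q : Matrix (Fin t) (Fin n) F, ‖∑ P ∈ S, ψ (Q * (M * P)).trace‖ ^ 2 := by
    refine (pow_le_pow_left₀ (norm_nonneg _) (norm_sum_le _ _) 2).trans ?_
    refine sq_sum_le_card_mul_sum_sq.trans (mul_le_mul_of_nonneg_left ?_ (Nat.cast_nonneg _))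
    exact Finset.sum_le_sum_of_subset_of_nonneg (Finset.subset_univ _) fun _ _ _ => by positivity
  have h2 : ∑ Q : Matrix (Fin t) (Fin n) F, ‖∑ P ∈ S, ψ (Q * (M * P)).trace‖ ^ 2 =
      ∑ P ∈ S, (Fintype.card F : ℝ) ^ (n * t) * ({P' ∈ S | M * (P - P') = 0}.card : ℝ) := by
    have h3 : ((∑ Q : Matrix (Fin t) (Fin n) F, ‖∑ P ∈ S, ψ (Q * (M * P)).trace‖ ^ 2 : ℝ) : ℂ) =
        ((∑ P ∈ S, (Fintype.card F : ℝ) ^ (n * t) * ({P' ∈ S | M * (P - P') = 0}.card : ℝ) : ℝ) :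
          ℂ) := by
      push_cast
      simp only [← Complex.mul_conj', map_sum, Finset.sum_mul_sum, ← AddChar.map_neg_eq_conj,
        ← AddChar.map_add_eq_mul, ← sub_eq_add_neg, ← Matrix.trace_sub, ← Matrix.mul_sub]
      rw [Finset.sum_comm]
      refine Finset.sum_congr rfl fun P _ => ?_
      rw [Finset.sum_comm]
      simp only [sum_addChar_trace_mul hψ]
      rw [← Finset.sum_filter, Finset.sum_const, nsmul_eq_mul, mul_comm]
      congr 1
      have := card_matrix_real (F := F) t n
      rw [mul_comm n t]
      exact_mod_cast this
    exact_mod_cast h3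
  have h4 : ∀ P ∈ S, (Fintype.card F : ℝ) ^ (n * t) * ({P' ∈ S | M * (P - P') = 0}.card : ℝ) ≤
      (Fintype.card F : ℝ) ^ (n * t) *
        ((Fintype.card F : ℝ) ^ (n * t) * ((Fintype.card F : ℝ)⁻¹ ^ t) ^ M.rank) := by
    intro P _
    refine mul_le_mul_of_nonneg_left ?_ (by positivity)
    rw [← card_mul_eq_zero_real]
    have h5 : {P' ∈ S | M * (P - P') = 0}.card ≤
        {P : Matrix (Fin n) (Fin t) F | M * P = 0}.ncard := by
      rw [← Set.ncard_coe_finset]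
      refine Set.ncard_le_ncard_of_injOn (fun P' => P - P') (fun P' hP' => ?_)
        (fun _ _ _ _ h => sub_right_injective h) (Set.toFinite _)
      simp only [Finset.coe_filter, Set.mem_ofPred_eq] at hP' ⊢
      exact hP'.2
    exact_mod_cast h5
  rw [h2] at h1
  refine (h1.trans (mul_le_mul_of_nonneg_left (Finset.sum_le_sum h4) (Nat.cast_nonneg _))).trans_eq
    ?_
  rw [Finset.sum_const, nsmul_eq_mul]
  ring

end MatrixCharacters

/-! ### A uniform lower bound for finite q-Pochhammer products. -/

section PochhammerBound

/-- The bound 1/4 alone does not pass through the induction. With z = 2^(-(n+2)) the added term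
works, because (1/4 + z)(1 - z) ≥ 1/4 + z/2 exactly when z ≤ 1/4. -/
lemma quarter_add_le_prod_one_sub_half_pow (n : ℕ) :
    1 / 4 + (1 / 2 : ℝ) ^ (n + 2) ≤ ∏ j ∈ Finset.range (n + 1), (1 - (1 / 2 : ℝ) ^ (j + 1)) := by
  induction n with
  | zero => norm_num
  | succ n ih =>
    rw [Finset.prod_range_succ]
    have hz : (1 / 2 : ℝ) ^ (n + 2) ≤ 1 / 4 := by
      calc (1 / 2 : ℝ) ^ (n + 2) ≤ (1 / 2 : ℝ) ^ 2 :=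
            pow_le_pow_of_le_one (by norm_num) (by norm_num) (by omega)
        _ = 1 / 4 := by norm_num
    have hz0 : 0 < (1 / 2 : ℝ) ^ (n + 2) := by positivity
    have h3 : (1 / 2 : ℝ) ^ (n + 1 + 2) = (1 / 2 : ℝ) ^ (n + 2) / 2 := by ring
    rw [h3]
    have h4 : (1 / 2 : ℝ) ^ (n + 1 + 1) = (1 / 2 : ℝ) ^ (n + 2) := rfl
    rw [h4]
    nlinarith

/-- The finite `q`-Pochhammer products `(x; x)_n` with `x ≤ 1 / 2` are at least `1 / 4`. -/
lemma quarter_le_prod_one_sub_pow {x : ℝ} (hx0 : 0 ≤ x) (hx : x ≤ 1 / 2) (n : ℕ) :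
    1 / 4 ≤ ∏ j ∈ Finset.range n, (1 - x ^ (j + 1)) := by
  have h1 : ∏ j ∈ Finset.range n, (1 - (1 / 2 : ℝ) ^ (j + 1)) ≤
      ∏ j ∈ Finset.range n, (1 - x ^ (j + 1)) := by
    refine Finset.prod_le_prod (fun j _ => ?_) fun j _ => ?_
    · exact sub_nonneg.2 (pow_le_one₀ (by norm_num) (by norm_num))
    · exact sub_le_sub_left (pow_le_pow_left₀ hx0 hx _) _
  refine le_trans ?_ h1
  cases n with
  | zero => norm_num
  | succ n =>
    refine le_trans ?_ (quarter_add_le_prod_one_sub_half_pow n)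
    exact le_add_of_nonneg_right (by positivity)

end PochhammerBound

/-! ### Densities of full-rank matrices and of determinant fibres. -/

section MatrixSets

variable {F : Type u} [Field F]

lemma inv_card_pos (F : Type u) [Field F] [Fintype F] : 0 < (Fintype.card F : ℝ)⁻¹ :=
  inv_pos.2 (by exact_mod_cast Fintype.card_pos)

lemma inv_card_le_half (F : Type u) [Field F] [Fintype F] : (Fintype.card F : ℝ)⁻¹ ≤ 1 / 2 := by
  rw [one_div]
  refine inv_anti₀ (by norm_num) ?_
  exact_mod_cast Fintype.one_lt_card (α := F)

lemma Matrix.rank_mul_eq_of_rank_eq_width {l n t : ℕ} {P : Matrix (Fin n) (Fin t) F}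
    (hP : P.rank = t) (Q : Matrix (Fin t) (Fin l) F) : (P * Q).rank = Q.rank := by
  have h2 := P.mulVecLin.finrank_range_add_finrank_ker
  rw [Module.finrank_fin_fun] at h2
  have h3 : Module.finrank F (LinearMap.range P.mulVecLin) = t := hP
  have h4 : LinearMap.ker P.mulVecLin = ⊥ := Submodule.finrank_eq_zero.1 (by omega)
  rw [Matrix.rank, Matrix.rank, Matrix.mulVecLin_mul, LinearMap.range_comp]
  exact (Submodule.equivMapOfInjective _ (LinearMap.ker_eq_bot.1 h4) _).finrank_eq.symm

lemma exists_det_eq {n : ℕ} (hn : 0 < n) (c : F) : ∃ D : Matrix (Fin n) (Fin n) F, D.det = c := by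
  refine ⟨Matrix.diagonal (Function.update 1 ⟨0, hn⟩ c), ?_⟩
  rw [Matrix.det_diagonal, Finset.prod_update_of_mem (Finset.mem_univ _)]
  simp

lemma Matrix.det_ne_zero_of_rank_eq {n : ℕ} {Z : Matrix (Fin n) (Fin n) F} (h : Z.rank = n) :
    Z.det ≠ 0 := by
  intro h0
  obtain ⟨v, hv, hv0⟩ := Matrix.exists_mulVec_eq_zero_iff.2 h0
  have h2 := Z.mulVecLin.finrank_range_add_finrank_ker
  rw [Module.finrank_fin_fun] at h2
  have h3 : Module.finrank F (LinearMap.range Z.mulVecLin) = n := h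
  have h4 : LinearMap.ker Z.mulVecLin = ⊥ := Submodule.finrank_eq_zero.1 (by omega)
  have h5 : v ∈ LinearMap.ker Z.mulVecLin := hv0
  rw [h4] at h5
  exact hv h5

variable [Fintype F]

open Classical in
/-- The matrices of rank `t` with `n` rows and `t` columns. -/
noncomputable def fullRankTall (F : Type u) [Field F] [Fintype F] (n t : ℕ) :
    Finset (Matrix (Fin n) (Fin t) F) :=
  {P | P.rank = t}

open Classical in
/-- The matrices of rank `t` with `t` rows and `n` columns. -/
noncomputable def fullRankWide (F : Type u) [Field F] [Fintype F] (t n : ℕ) :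
    Finset (Matrix (Fin t) (Fin n) F) :=
  {Q | Q.rank = t}

open Classical in
/-- The `n × n` matrices of determinant `a`. -/
noncomputable def detFiber (n : ℕ) (a : F) : Finset (Matrix (Fin n) (Fin n) F) :=
  {Z | Z.det = a}

lemma mem_fullRankTall {n t : ℕ} {P : Matrix (Fin n) (Fin t) F} :
    P ∈ fullRankTall F n t ↔ P.rank = t := by
  simp [fullRankTall]

lemma mem_fullRankWide {n t : ℕ} {Q : Matrix (Fin t) (Fin n) F} :
    Q ∈ fullRankWide F t n ↔ Q.rank = t := by
  simp [fullRankWide]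

lemma mem_detFiber {n : ℕ} {a : F} {Z : Matrix (Fin n) (Fin n) F} :
    Z ∈ detFiber n a ↔ Z.det = a := by
  simp [detFiber]

lemma card_fullRankWide {t n : ℕ} (ht : t ≤ n) :
    (fullRankWide F t n).card = ∏ i : Fin t, (Fintype.card F ^ n - Fintype.card F ^ i.val) := by
  have h1 := card_linearIndependent (K := F) (V := Fin n → F) (k := t) (by simpa using ht)
  rw [Module.finrank_fin_fun] at h1
  rw [← h1, fullRankWide, ← Fintype.card_subtype, ← Nat.card_eq_fintype_card]
  refine Nat.card_congr (Equiv.subtypeEquiv Matrix.of.symm fun Q => ?_)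
  rw [linearIndependent_iff_card_eq_finrank_span, Matrix.rank_eq_finrank_span_row,
    Fintype.card_fin, eq_comm]
  rfl

/-- The density is the product of 1 - q^(-(n-i)) over i < t, a partial product of the Pochhammer
product of length n. -/
lemma le_card_fullRankWide {t n : ℕ} (ht : t ≤ n) :
    (Fintype.card F : ℝ) ^ (n * t) / 4 ≤ (fullRankWide F t n).card := by
  have hq : (Fintype.card F : ℝ) ≠ 0 := by exact_mod_cast Fintype.card_ne_zero
  set x : ℝ := (Fintype.card F : ℝ)⁻¹ with hx
  have hx0 : 0 < x := inv_card_pos F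
  have hx1 : x ≤ 1 / 2 := inv_card_le_half F
  have h1 : ((fullRankWide F t n).card : ℝ) =
      (Fintype.card F : ℝ) ^ (n * t) * ∏ i ∈ Finset.range t, (1 - x ^ (n - i)) := by
    rw [card_fullRankWide ht, Fin.prod_univ_eq_prod_range
      (fun i => Fintype.card F ^ n - Fintype.card F ^ i), Nat.cast_prod, pow_mul,
      ← Finset.card_range t, ← Finset.prod_const, Finset.card_range, ← Finset.prod_mul_distrib]
    refine Finset.prod_congr rfl fun i hi => ?_
    have hi' : i < t := Finset.mem_range.1 hi
    rw [Nat.cast_sub (Nat.pow_le_pow_right Fintype.card_pos (by omega)), Nat.cast_pow,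
      Nat.cast_pow, mul_sub, mul_one, hx, inv_pow]
    congr 1
    rw [eq_mul_inv_iff_mul_eq₀ (pow_ne_zero _ hq), ← pow_add]
    congr 1
    omega
  rw [h1, div_eq_mul_one_div]
  refine mul_le_mul_of_nonneg_left ?_ (by positivity)
  have h2 : ∀ i, 0 ≤ 1 - x ^ (n - i) ∧ 1 - x ^ (n - i) ≤ 1 := fun i =>
    ⟨sub_nonneg.2 (pow_le_one₀ hx0.le (by linarith)), sub_le_self _ (by positivity)⟩
  calc 1 / 4 ≤ ∏ j ∈ Finset.range n, (1 - x ^ (j + 1)) := quarter_le_prod_one_sub_pow hx0.le hx1 n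
    _ = ∏ i ∈ Finset.range n, (1 - x ^ (n - i)) := by
      rw [← Finset.prod_range_reflect]
      refine Finset.prod_congr rfl fun i hi => ?_
      have hi' : i < n := Finset.mem_range.1 hi
      congr 2
      omega
    _ ≤ ∏ i ∈ Finset.range t, (1 - x ^ (n - i)) := by
      have hnt : n = t + (n - t) := by omega
      conv_lhs => rw [hnt, Finset.prod_range_add, ← hnt]
      refine mul_le_of_le_one_right (Finset.prod_nonneg fun i _ => (h2 i).1) ?_
      exact Finset.prod_le_one (fun i _ => (h2 _).1) fun i _ => (h2 _).2

lemma card_fullRankTall (n t : ℕ) : (fullRankTall F n t).card = (fullRankWide F t n).card := by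
  refine Finset.card_bij (fun P _ => Pᵀ) (fun P hP => ?_) (fun _ _ _ _ h => ?_) fun Q hQ => ?_
  · rw [mem_fullRankWide, Matrix.rank_transpose]
    exact mem_fullRankTall.1 hP
  · exact Matrix.transpose_injective h
  · refine ⟨Qᵀ, ?_, Matrix.transpose_transpose Q⟩
    rw [mem_fullRankTall, Matrix.rank_transpose]
    exact mem_fullRankWide.1 hQ

lemma le_card_fullRankTall {t n : ℕ} (ht : t ≤ n) :
    (Fintype.card F : ℝ) ^ (n * t) / 4 ≤ (fullRankTall F n t).card := by
  rw [card_fullRankTall]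
  exact le_card_fullRankWide ht

/-- Multiplication by a fixed matrix of determinant a / b injects one fibre into the other. -/
lemma card_detFiber_le {n : ℕ} (hn : 0 < n) {a b : F} (ha : a ≠ 0) (hb : b ≠ 0) :
    (detFiber n b).card ≤ (detFiber n a).card := by
  obtain ⟨D, hD⟩ := exists_det_eq hn (a / b)
  have hD0 : IsUnit D.det := by
    rw [hD]
    exact (div_ne_zero ha hb).isUnit
  refine Finset.card_le_card_of_injOn (fun Z => D * Z) (fun Z hZ => ?_) fun Z _ W _ h => ?_
  · rw [Finset.mem_coe, mem_detFiber] at hZ ⊢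
    rw [Matrix.det_mul, hZ, hD, div_mul_cancel₀ _ hb]
  · have h2 : D⁻¹ * (D * Z) = D⁻¹ * (D * W) := congrArg _ h
    rwa [Matrix.nonsing_inv_mul_cancel_left _ _ hD0,
      Matrix.nonsing_inv_mul_cancel_left _ _ hD0] at h2

/-- The invertible matrices, of density at least 1/4, split into at most q nonempty determinant
fibres, none larger than the one over a. -/
lemma le_card_detFiber {n : ℕ} (hn : 0 < n) {a : F} (ha : a ≠ 0) :
    (Fintype.card F : ℝ) ^ (n * n) / (4 * Fintype.card F) ≤ (detFiber n a).card := by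
  classical
  have h1 : (fullRankWide F n n).card ≤ (detFiber n a).card * (Finset.univ : Finset F).card := by
    refine Finset.card_le_mul_card_image_of_maps_to (f := Matrix.det) (fun _ _ => Finset.mem_univ _)
      _ fun b _ => ?_
    by_cases hb : b = 0
    · rw [Finset.card_eq_zero.2]
      · exact Nat.zero_le _
      · rw [Finset.filter_eq_empty_iff]
        intro Z hZ
        rw [hb]
        exact Matrix.det_ne_zero_of_rank_eq (mem_fullRankWide.1 hZ)
    · refine (Finset.card_le_card fun Z hZ => ?_).trans (card_detFiber_le hn ha hb)
      exact mem_detFiber.2 (Finset.mem_filter.1 hZ).2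
  have h2 : ((fullRankWide F n n).card : ℝ) ≤ (detFiber n a).card * Fintype.card F := by
    exact_mod_cast h1
  have h3 := (le_card_fullRankWide (F := F) (le_refl n)).trans h2
  have hq : 0 < (Fintype.card F : ℝ) := by exact_mod_cast Fintype.card_pos
  rw [div_le_iff₀ (by positivity)]
  linarith

end MatrixSets

/-! ### Orbits of matrices under GL_n × GL_n and SL_n × SL_n. -/

section RankOrbits

variable {F : Type u} [Field F]

lemma Matrix.exists_mul_mul_eq_of_rank_eq {n : ℕ} {M N : Matrix (Fin n) (Fin n) F}
    (h : M.rank = N.rank) :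
    ∃ G H : Matrix (Fin n) (Fin n) F, G.det ≠ 0 ∧ H.det ≠ 0 ∧ N = G * M * H := by
  -- The rank is replaced by a variable s so that both normal forms have blocks indexed by the same
  -- types. They may still use different bijections; the permutation `σ` below reconciles them.
  have key : ∀ A : Matrix (Fin n) (Fin n) F, ∀ s, A.rank = s → ∃ (V U : Matrix (Fin n) (Fin n) F)
      (e : Fin n ≃ Fin s ⊕ Fin (Fintype.card (Fin n) - s)), IsUnit V.det ∧ IsUnit U.det ∧
      V * A * U = (Matrix.fromBlocks 1 0 0 0).submatrix e e := by
    rintro A s rfl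
    obtain ⟨V, U, e, hV, hU, h⟩ := A.exists_rank_normal_form
    exact ⟨V, U, e, (Matrix.isUnit_iff_isUnit_det _).1 hV, (Matrix.isUnit_iff_isUnit_det _).1 hU, h⟩
  obtain ⟨V, U, e, hV, hU, h1⟩ := key M _ h
  obtain ⟨V', U', e', hV', hU', h2⟩ := key N _ rfl
  let σ : Fin n ≃ Fin n := e'.trans e.symm
  let p : Matrix (Fin n) (Fin n) F := (1 : Matrix (Fin n) (Fin n) F).submatrix σ id
  let p' : Matrix (Fin n) (Fin n) F := (1 : Matrix (Fin n) (Fin n) F).submatrix id σ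
  have hpp : p * p' = 1 := by
    ext i j
    simp [p, p', Matrix.mul_apply, Matrix.one_apply]
  have hdet : p.det * p'.det = 1 := by rw [← Matrix.det_mul, hpp, Matrix.det_one]
  have h3 : V' * N * U' = p * (V * M * U) * p' := by
    rw [h1, h2]
    ext i j
    simp [p, p', σ, Matrix.mul_apply, Matrix.one_apply]
  refine ⟨V'⁻¹ * p * V, U * p' * U'⁻¹, ?_, ?_, ?_⟩
  · rw [Matrix.det_mul, Matrix.det_mul]
    exact mul_ne_zero (mul_ne_zero (Matrix.isUnit_nonsing_inv_det _ hV').ne_zero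
      (left_ne_zero_of_mul_eq_one hdet)) hV.ne_zero
  · rw [Matrix.det_mul, Matrix.det_mul]
    exact mul_ne_zero (mul_ne_zero hU.ne_zero (right_ne_zero_of_mul_eq_one hdet))
      (Matrix.isUnit_nonsing_inv_det _ hU').ne_zero
  · have h4 : V'⁻¹ * (V' * N * U') * U'⁻¹ = N := by
      rw [Matrix.mul_assoc V', Matrix.nonsing_inv_mul_cancel_left _ _ hV',
        Matrix.mul_nonsing_inv_cancel_right _ _ hU']
    rw [← h4, h3]
    simp only [Matrix.mul_assoc]

/-- A rank-one update 1 + u vᵀ with v in the left kernel of M fixes M, and its determinant 1 + v·u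
can be chosen at will. -/
lemma Matrix.exists_mul_eq_self_det_eq {n : ℕ} {M : Matrix (Fin n) (Fin n) F} (h : M.det = 0)
    (c : F) : ∃ K : Matrix (Fin n) (Fin n) F, K * M = M ∧ K.det = c := by
  obtain ⟨v, hv, hv0⟩ := Matrix.exists_vecMul_eq_zero_iff.2 h
  obtain ⟨i, hi⟩ := Function.ne_iff.1 hv
  refine ⟨1 + Matrix.replicateCol Unit (Pi.single i ((c - 1) / v i)) * Matrix.replicateRow Unit v,
    ?_, ?_⟩
  · rw [Matrix.add_mul, Matrix.one_mul, Matrix.mul_assoc]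
    have h1 : Matrix.replicateRow Unit v * M = 0 := by
      ext a b
      exact congr_fun hv0 b
    rw [h1, Matrix.mul_zero, add_zero]
  · rw [Matrix.det_one_add_replicateCol_mul_replicateRow, dotProduct_single,
      mul_div_cancel₀ _ hi]
    ring

/-- Matrices of the same rank below `n` are equivalent under `SL_n × SL_n`. -/
lemma Matrix.exists_mul_mul_eq_of_rank_eq_of_lt {n : ℕ} {M N : Matrix (Fin n) (Fin n) F}
    (h : M.rank = N.rank) (hN : N.rank < n) :
    ∃ G H : Matrix (Fin n) (Fin n) F, G.det = 1 ∧ H.det = 1 ∧ N = G * M * H := by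
  obtain ⟨G, H, hG, hH, hGH⟩ := Matrix.exists_mul_mul_eq_of_rank_eq h
  have hdet : N.det = 0 := by
    by_contra h0
    rw [Matrix.rank_of_det_ne_zero h0, Fintype.card_fin] at hN
    exact lt_irrefl _ hN
  -- As N is singular, factors that fix N absorb the determinants of G and H.
  obtain ⟨K, hK, hKdet⟩ := Matrix.exists_mul_eq_self_det_eq hdet G.det⁻¹
  obtain ⟨L, hL, hLdet⟩ := Matrix.exists_mul_eq_self_det_eq
    ((Matrix.det_transpose N).trans hdet) H.det⁻¹
  have hL' : N * Lᵀ = N := by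
    rw [← Matrix.transpose_inj, Matrix.transpose_mul, Matrix.transpose_transpose, hL]
  refine ⟨K * G, H * Lᵀ, ?_, ?_, ?_⟩
  · rw [Matrix.det_mul, hKdet, inv_mul_cancel₀ hG]
  · rw [Matrix.det_mul, Matrix.det_transpose, hLdet, mul_inv_cancel₀ hH]
  · calc N = K * N * Lᵀ := by rw [hK, hL']
      _ = K * G * M * (H * Lᵀ) := by
        conv_lhs => rw [hGH]
        simp only [Matrix.mul_assoc]

end RankOrbits

/-! ### Laws of random products, and their Fourier transforms. -/

section ProductLaw

variable {F : Type u} [Field F] {n t : ℕ}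

open Classical in
/-- The law of `P * Q` for independent uniform `P ∈ S` and `Q ∈ R`. -/
noncomputable def productLaw (S : Finset (Matrix (Fin n) (Fin t) F))
    (R : Finset (Matrix (Fin t) (Fin n) F)) (Z : Matrix (Fin n) (Fin n) F) : ℝ :=
  (∑ P ∈ S, ∑ Q ∈ R, if P * Q = Z then 1 else 0) / (S.card * R.card)

variable {S : Finset (Matrix (Fin n) (Fin t) F)} {R : Finset (Matrix (Fin t) (Fin n) F)}

lemma productLaw_nonneg (Z : Matrix (Fin n) (Fin n) F) : 0 ≤ productLaw S R Z := by
  refine div_nonneg (Finset.sum_nonneg fun _ _ => Finset.sum_nonneg fun _ _ => ?_) (by positivity)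
  split_ifs <;> norm_num

lemma exists_mul_eq_of_productLaw_ne_zero {Z : Matrix (Fin n) (Fin n) F}
    (h : productLaw S R Z ≠ 0) : ∃ P ∈ S, ∃ Q ∈ R, P * Q = Z := by
  by_contra! hc
  refine h ?_
  rw [productLaw, Finset.sum_eq_zero, zero_div]
  exact fun P hP => Finset.sum_eq_zero fun Q hQ => if_neg (hc P hP Q hQ)

variable [Fintype F]

lemma sum_productLaw_mul {𝕜 : Type*} [RCLike 𝕜] (g : Matrix (Fin n) (Fin n) F → 𝕜) :
    ∑ Z, (productLaw S R Z : 𝕜) * g Z =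
      (∑ P ∈ S, ∑ Q ∈ R, g (P * Q)) / (S.card * R.card : 𝕜) := by
  classical
  have h : ∀ Z, (productLaw S R Z : 𝕜) * g Z =
      (∑ P ∈ S, ∑ Q ∈ R, if P * Q = Z then g Z else 0) / (S.card * R.card : 𝕜) := by
    intro Z
    rw [productLaw]
    push_cast
    rw [div_mul_eq_mul_div, Finset.sum_mul]
    congr 1
    refine Finset.sum_congr rfl fun P _ => ?_
    rw [Finset.sum_mul]
    refine Finset.sum_congr rfl fun Q _ => ?_
    split_ifs <;> simp
  simp only [h]
  rw [← Finset.sum_div, Finset.sum_comm]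
  congr 1
  refine Finset.sum_congr rfl fun P _ => ?_
  rw [Finset.sum_comm]
  refine Finset.sum_congr rfl fun Q _ => ?_
  simp

lemma sum_productLaw (hS : S.Nonempty) (hR : R.Nonempty) : ∑ Z, productLaw S R Z = 1 := by
  have h := sum_productLaw_mul (𝕜 := ℝ) (S := S) (R := R) (fun _ => 1)
  simp only [RCLike.ofReal_real_eq_id, id, mul_one, Finset.sum_const, nsmul_eq_mul] at h
  rw [h, div_self]
  have := hS.card_pos
  have := hR.card_pos
  positivity

variable {ψ : AddChar F ℂ}

lemma matrixFourier_productLaw (M : Matrix (Fin n) (Fin n) F) :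
    matrixFourier ψ (fun Z => (productLaw S R Z : ℂ)) M =
      (∑ P ∈ S, ∑ Q ∈ R, ψ (P * Q * M).trace) / (S.card * R.card : ℂ) :=
  sum_productLaw_mul (𝕜 := ℂ) (fun Z : Matrix (Fin n) (Fin n) F => ψ (Z * M).trace)

/-- The product form of the law is what makes the bilinear Cauchy–Schwarz bound available. Here 1/c
bounds the densities of both factors from below: c = 4 for full rank, c = 4q for determinant fibres.
-/
lemma norm_matrixFourier_productLaw_sq_le (hψ : ψ.IsPrimitive) (M : Matrix (Fin n) (Fin n) F)
    {c : ℝ} (hc : 0 < c) (hS : (Fintype.card F : ℝ) ^ (n * t) / c ≤ S.card)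
    (hR : (Fintype.card F : ℝ) ^ (n * t) / c ≤ R.card) :
    ‖matrixFourier ψ (fun Z => (productLaw S R Z : ℂ)) M‖ ^ 2 ≤
      c ^ 2 * ((Fintype.card F : ℝ)⁻¹ ^ t) ^ M.rank := by
  have hq : 0 < (Fintype.card F : ℝ) := by exact_mod_cast Fintype.card_pos
  set D : ℝ := (Fintype.card F : ℝ) ^ (n * t) with hD
  have hD0 : 0 < D := by positivity
  have hS0 : 0 < (S.card : ℝ) := lt_of_lt_of_le (by positivity) hS
  have hR0 : 0 < (R.card : ℝ) := lt_of_lt_of_le (by positivity) hR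
  have h1 := norm_sum_addChar_trace_mul_sq_le hψ S R M
  rw [← hD] at h1
  rw [matrixFourier_productLaw, norm_div, norm_mul, Complex.norm_natCast, Complex.norm_natCast,
    div_pow, div_le_iff₀ (by positivity)]
  refine h1.trans ?_
  set y : ℝ := ((Fintype.card F : ℝ)⁻¹ ^ t) ^ M.rank with hy
  have hy0 : 0 ≤ y := by positivity
  rw [div_le_iff₀ hc] at hS hR
  have h2 : D ^ 2 ≤ c ^ 2 * (S.card * R.card) := by nlinarith
  calc (S.card : ℝ) * R.card * D ^ 2 * y ≤ (S.card : ℝ) * R.card * (c ^ 2 * (S.card * R.card)) * y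
        := by gcongr
    _ = c ^ 2 * y * (S.card * R.card) ^ 2 := by ring

/-- Substitute P ↦ HP and Q ↦ QG, and use that the trace is cyclic. -/
lemma matrixFourier_productLaw_equivalent (M : Matrix (Fin n) (Fin n) F)
    {G H : Matrix (Fin n) (Fin n) F} (hG : IsUnit G.det) (hH : IsUnit H.det)
    (hS : ∀ P, H * P ∈ S ↔ P ∈ S) (hR : ∀ Q, Q * G ∈ R ↔ Q ∈ R) :
    matrixFourier ψ (fun Z => (productLaw S R Z : ℂ)) (G * M * H) =
      matrixFourier ψ (fun Z => (productLaw S R Z : ℂ)) M := by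
  rw [matrixFourier_productLaw, matrixFourier_productLaw]
  congr 1
  refine Finset.sum_bij (fun P _ => H * P) (fun P hP => (hS P).2 hP) (fun P _ P' _ h => ?_)
    (fun P hP => ⟨H⁻¹ * P, ?_, ?_⟩) fun P _ => ?_
  · have h2 : H⁻¹ * (H * P) = H⁻¹ * (H * P') := congrArg _ h
    rwa [Matrix.nonsing_inv_mul_cancel_left _ _ hH, Matrix.nonsing_inv_mul_cancel_left _ _ hH] at h2
  · rwa [← hS, Matrix.mul_nonsing_inv_cancel_left _ _ hH]
  · exact Matrix.mul_nonsing_inv_cancel_left _ _ hH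
  · refine Finset.sum_bij (fun Q _ => Q * G) (fun Q hQ => (hR Q).2 hQ) (fun Q _ Q' _ h => ?_)
      (fun Q hQ => ⟨Q * G⁻¹, ?_, ?_⟩) fun Q _ => ?_
    · have h2 : Q * G * G⁻¹ = Q' * G * G⁻¹ := congrArg (· * G⁻¹) h
      rwa [Matrix.mul_nonsing_inv_cancel_right _ _ hG,
        Matrix.mul_nonsing_inv_cancel_right _ _ hG] at h2
    · rwa [← hR, Matrix.nonsing_inv_mul_cancel_right _ _ hG]
    · exact Matrix.nonsing_inv_mul_cancel_right _ _ hG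
    · congr 1
      rw [← Matrix.mul_assoc, Matrix.trace_mul_comm]
      simp only [Matrix.mul_assoc]

/-- The uniform law on products of full-rank factors, which is concentrated on rank `t`. -/
noncomputable def rankLaw (F : Type u) [Field F] [Fintype F] (n t : ℕ) :
    Matrix (Fin n) (Fin n) F → ℝ :=
  productLaw (fullRankTall F n t) (fullRankWide F t n)

/-- A law concentrated on the matrices of determinant `a`. -/
noncomputable def detLaw (n : ℕ) (a : F) : Matrix (Fin n) (Fin n) F → ℝ :=
  productLaw (detFiber n (1 : F)) (detFiber n a)

lemma rank_eq_of_rankLaw_ne_zero {Z : Matrix (Fin n) (Fin n) F} (h : rankLaw F n t Z ≠ 0) :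
    Z.rank = t := by
  obtain ⟨P, hP, Q, hQ, rfl⟩ := exists_mul_eq_of_productLaw_ne_zero h
  rw [Matrix.rank_mul_eq_of_rank_eq_width (mem_fullRankTall.1 hP), mem_fullRankWide.1 hQ]

lemma det_eq_of_detLaw_ne_zero {a : F} {Z : Matrix (Fin n) (Fin n) F} (h : detLaw n a Z ≠ 0) :
    Z.det = a := by
  obtain ⟨P, hP, Q, hQ, rfl⟩ := exists_mul_eq_of_productLaw_ne_zero h
  rw [Matrix.det_mul, mem_detFiber.1 hP, mem_detFiber.1 hQ, one_mul]

lemma fullRankTall_nonempty (ht : t ≤ n) : (fullRankTall F n t).Nonempty := by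
  have h := le_card_fullRankTall (F := F) ht
  have hq : 0 < (Fintype.card F : ℝ) := by exact_mod_cast Fintype.card_pos
  have h2 : 0 < ((fullRankTall F n t).card : ℝ) := lt_of_lt_of_le (by positivity) h
  exact Finset.card_pos.1 (by exact_mod_cast h2)

lemma fullRankWide_nonempty (ht : t ≤ n) : (fullRankWide F t n).Nonempty := by
  rw [← Finset.card_pos, ← card_fullRankTall, Finset.card_pos]
  exact fullRankTall_nonempty ht

lemma detFiber_nonempty (hn : 0 < n) (a : F) : (detFiber n a).Nonempty := by
  obtain ⟨D, hD⟩ := exists_det_eq hn a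
  exact ⟨D, mem_detFiber.2 hD⟩

lemma sum_rankLaw (ht : t ≤ n) : ∑ Z, rankLaw F n t Z = 1 :=
  sum_productLaw (fullRankTall_nonempty ht) (fullRankWide_nonempty ht)

lemma sum_detLaw (hn : 0 < n) (a : F) : ∑ Z, detLaw n a Z = 1 :=
  sum_productLaw (detFiber_nonempty hn 1) (detFiber_nonempty hn a)

lemma matrixFourier_rankLaw_equivalent (M : Matrix (Fin n) (Fin n) F)
    {G H : Matrix (Fin n) (Fin n) F} (hG : G.det = 1) (hH : H.det = 1) :
    matrixFourier ψ (fun Z => (rankLaw F n t Z : ℂ)) (G * M * H) =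
      matrixFourier ψ (fun Z => (rankLaw F n t Z : ℂ)) M := by
  have hG' : IsUnit G.det := hG ▸ isUnit_one
  have hH' : IsUnit H.det := hH ▸ isUnit_one
  refine matrixFourier_productLaw_equivalent M hG' hH' (fun P => ?_) fun Q => ?_
  · rw [mem_fullRankTall, mem_fullRankTall, Matrix.rank_mul_eq_right_of_isUnit_det _ _ hH']
  · rw [mem_fullRankWide, mem_fullRankWide, Matrix.rank_mul_eq_left_of_isUnit_det _ _ hG']

lemma matrixFourier_detLaw_equivalent (a : F) (M : Matrix (Fin n) (Fin n) F)
    {G H : Matrix (Fin n) (Fin n) F} (hG : G.det = 1) (hH : H.det = 1) :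
    matrixFourier ψ (fun Z => (detLaw n a Z : ℂ)) (G * M * H) =
      matrixFourier ψ (fun Z => (detLaw n a Z : ℂ)) M := by
  refine matrixFourier_productLaw_equivalent M (hG ▸ isUnit_one) (hH ▸ isUnit_one)
    (fun P => ?_) fun Q => ?_
  · rw [mem_detFiber, mem_detFiber, Matrix.det_mul, hH, one_mul]
  · rw [mem_detFiber, mem_detFiber, Matrix.det_mul, hG, mul_one]

lemma norm_matrixFourier_rankLaw_le (hψ : ψ.IsPrimitive) (ht : t ≤ n)
    (M : Matrix (Fin n) (Fin n) F) :
    ‖matrixFourier ψ (fun Z => (rankLaw F n t Z : ℂ)) M‖ ≤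
      4 * √(Fintype.card F : ℝ)⁻¹ ^ (t * M.rank) := by
  refine le_of_sq_le_sq ?_ (by positivity)
  refine (norm_matrixFourier_productLaw_sq_le hψ M four_pos (le_card_fullRankTall ht)
    (le_card_fullRankWide ht)).trans_eq ?_
  rw [mul_pow, ← pow_mul √_, mul_comm (t * M.rank), pow_mul √_, Real.sq_sqrt (inv_card_pos F).le,
    pow_mul]

lemma norm_matrixFourier_detLaw_le (hψ : ψ.IsPrimitive) (hn : 0 < n) {a : F} (ha : a ≠ 0)
    (M : Matrix (Fin n) (Fin n) F) :
    ‖matrixFourier ψ (fun Z => (detLaw n a Z : ℂ)) M‖ ≤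
      4 * Fintype.card F * √(Fintype.card F : ℝ)⁻¹ ^ (n * M.rank) := by
  have hq : 0 < (Fintype.card F : ℝ) := by exact_mod_cast Fintype.card_pos
  refine le_of_sq_le_sq ?_ (by positivity)
  refine (norm_matrixFourier_productLaw_sq_le hψ M (by positivity)
    (le_card_detFiber hn one_ne_zero) (le_card_detFiber hn ha)).trans_eq ?_
  rw [mul_pow _ (√_ ^ _), ← pow_mul √_, mul_comm (n * M.rank), pow_mul √_,
    Real.sq_sqrt (inv_card_pos F).le, pow_mul]

/-- If a function on matrices has no correlation with `q ^ (-j rk Z)` for `j ≤ d`, and its Fourier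
coefficients at matrices of rank at most `d` depend only on the rank, then they vanish. -/
theorem matrixFourier_eq_zero_of_rank_le (hψ : ψ.IsPrimitive) {f : Matrix (Fin n) (Fin n) F → ℂ}
    {d : ℕ} (hd : d ≤ n)
    (hf : ∀ M M' : Matrix (Fin n) (Fin n) F, M.rank ≤ d → M.rank = M'.rank →
      matrixFourier ψ f M = matrixFourier ψ f M')
    (hmom : ∀ j ≤ d, ∑ Z, f Z * ((((Fintype.card F : ℝ)⁻¹ ^ j) ^ Z.rank : ℝ) : ℂ) = 0)
    (M : Matrix (Fin n) (Fin n) F) (hM : M.rank ≤ d) : matrixFourier ψ f M = 0 := by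
  classical
  induction h : M.rank using Nat.strong_induction_on generalizing M with
  | _ s ih =>
  subst h
  -- Summed over all L and R of inner dimension rk M, the transform gives a multiple of the moment
  -- of order rk M, which vanishes.
  have h1 : ∑ L : Matrix (Fin n) (Fin M.rank) F, ∑ R : Matrix (Fin M.rank) (Fin n) F,
      matrixFourier ψ f (L * R) = 0 := by
    have h2 : ∀ L : Matrix (Fin n) (Fin M.rank) F, ∑ R : Matrix (Fin M.rank) (Fin n) F,
        matrixFourier ψ f (L * R) =
        ∑ Z, f Z * ∑ R : Matrix (Fin M.rank) (Fin n) F, ψ (Z * (L * R)).trace := by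
      intro L
      simp only [matrixFourier, Finset.mul_sum]
      exact Finset.sum_comm
    simp only [h2]
    rw [Finset.sum_comm]
    simp only [← Finset.mul_sum, sum_addChar_trace_mul_mul hψ]
    have h3 := congrArg (fun z => z * (((Fintype.card F : ℝ) ^ (M.rank * n) *
      (Fintype.card F : ℝ) ^ (n * M.rank) : ℝ) : ℂ)) (hmom M.rank hM)
    rw [zero_mul, Finset.sum_mul] at h3
    rw [← h3]
    refine Finset.sum_congr rfl fun Z _ => ?_
    push_cast
    ring
  -- A product LR has rank at most rk M. Smaller ranks contribute zero by induction, so the sum is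
  -- the value at M times the number of pairs of full rank product, and such pairs exist.
  have h4 : ∀ (L : Matrix (Fin n) (Fin M.rank) F) (R : Matrix (Fin M.rank) (Fin n) F),
      matrixFourier ψ f (L * R) = if (L * R).rank = M.rank then matrixFourier ψ f M else 0 := by
    intro L R
    split_ifs with h5
    · exact (hf M (L * R) hM h5.symm).symm
    · have h6 : (L * R).rank ≤ M.rank := (Matrix.rank_mul_le_left L R).trans L.rank_le_width
      exact ih _ (lt_of_le_of_ne h6 h5) (L * R) (h6.trans hM) rfl
  simp only [h4] at h1
  rw [← Fintype.sum_prod_type', ← Finset.sum_filter, Finset.sum_const, nsmul_eq_mul] at h1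
  refine (mul_eq_zero.1 h1).resolve_left ?_
  obtain ⟨P, hP⟩ := fullRankTall_nonempty (F := F) (hM.trans hd)
  obtain ⟨Q, hQ⟩ := fullRankWide_nonempty (F := F) (hM.trans hd)
  refine Nat.cast_ne_zero.2 (Finset.card_ne_zero.2 ?_)
  refine ⟨(P, Q), Finset.mem_filter.2 ⟨Finset.mem_univ _, ?_⟩⟩
  rw [Matrix.rank_mul_eq_of_rank_eq_width (mem_fullRankTall.1 hP), mem_fullRankWide.1 hQ]

end ProductLaw

/-! ### Lagrange weights at geometric nodes. -/

section InterpolationWeights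

/-- The value at `x ^ r` of the Lagrange basis polynomial of index `t` for the nodes `x ^ j`,
`j ∈ {0, …, m, n}`. -/
noncomputable def interpWeight (x : ℝ) (m r n t : ℕ) : ℝ :=
  ∏ j ∈ (insert n (Finset.range (m + 1))).erase t, (x ^ r - x ^ j) / (x ^ t - x ^ j)

variable {x : ℝ} {m r n t : ℕ}

/-- Interpolation at m + 2 nodes is exact up to degree m + 1. -/
lemma sum_interpWeight_mul_pow (hx0 : 0 < x) (hx1 : x < 1) (hmn : m < n) {j : ℕ} (hj : j ≤ m + 1) :
    ∑ t ∈ insert n (Finset.range (m + 1)), interpWeight x m r n t * (x ^ j) ^ t = (x ^ j) ^ r := by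
  have hinj : Set.InjOn (fun t : ℕ => x ^ t) (insert n (Finset.range (m + 1)) : Finset ℕ) :=
    (pow_right_injective₀ hx0 hx1.ne).injOn
  have hcard : (insert n (Finset.range (m + 1))).card = m + 2 := by
    rw [Finset.card_insert_of_notMem (by simp; omega), Finset.card_range]
  have h := Lagrange.eq_interpolate (f := (Polynomial.X : Polynomial ℝ) ^ j) hinj (by
    rw [Polynomial.degree_X_pow, hcard]
    exact_mod_cast (by omega : j < m + 2))
  have h2 := congrArg (Polynomial.eval (x ^ r)) h
  rw [Lagrange.interpolate_apply, Polynomial.eval_finsetSum] at h2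
  simp only [Polynomial.eval_pow, Polynomial.eval_X, Polynomial.eval_mul, Polynomial.eval_C] at h2
  rw [← pow_mul, mul_comm, pow_mul, h2]
  refine Finset.sum_congr rfl fun t _ => ?_
  rw [← pow_mul, mul_comm j, pow_mul, mul_comm]
  congr 1
  rw [Lagrange.basis, Polynomial.eval_prod, interpWeight]
  refine Finset.prod_congr rfl fun i _ => ?_
  rw [Lagrange.basisDivisor]
  simp only [Polynomial.eval_mul, Polynomial.eval_C, Polynomial.eval_sub, Polynomial.eval_X]
  rw [div_eq_inv_mul]

/-- Each factor lies in [0, 1] because x^r lies between x^n and every x^j with j ≤ m. The sign lets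
the witness be nonpositive at determinant a; the bound 1 controls the Fourier coefficient. -/
lemma interpWeight_last_mem_Icc (hx0 : 0 < x) (hx1 : x < 1) (hmr : m < r) (hrn : r < n) :
    interpWeight x m r n n ∈ Set.Icc 0 1 := by
  have h : ∀ j ∈ Finset.range (m + 1),
      0 ≤ (x ^ r - x ^ j) / (x ^ n - x ^ j) ∧ (x ^ r - x ^ j) / (x ^ n - x ^ j) ≤ 1 := by
    intro j hj
    have hj' : j < r := (Finset.mem_range_succ_iff.1 hj).trans_lt hmr
    have h1 : x ^ r < x ^ j := pow_lt_pow_right_of_lt_one₀ hx0 hx1 hj'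
    have h2 : x ^ n < x ^ r := pow_lt_pow_right_of_lt_one₀ hx0 hx1 hrn
    rw [← neg_div_neg_eq, neg_sub, neg_sub]
    refine ⟨div_nonneg (by linarith) (by linarith), ?_⟩
    rw [div_le_one (by linarith)]
    linarith
  rw [interpWeight, Finset.erase_insert (by simp; omega)]
  exact ⟨Finset.prod_nonneg fun j hj => (h j hj).1,
    Finset.prod_le_one (fun j hj => (h j hj).1) fun j hj => (h j hj).2⟩

lemma prod_range_inv_one_sub_pow_le (hx0 : 0 < x) (hx : x ≤ 1 / 2) (k : ℕ) :
    ∏ i ∈ Finset.range k, (1 - x ^ (i + 1))⁻¹ ≤ 4 := by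
  rw [Finset.prod_inv_distrib]
  have h := quarter_le_prod_one_sub_pow hx0.le hx k
  calc _ ≤ (1 / 4 : ℝ)⁻¹ := inv_anti₀ (by norm_num) h
    _ = 4 := by norm_num

lemma abs_interpWeight_le (hx0 : 0 < x) (hx : x ≤ 1 / 2) (ht : t ≤ m) (hmr : m < r)
    (hrn : r < n) :
    |interpWeight x m r n t| ≤
      16 * x ^ (r - t + ∑ i ∈ Finset.range (m - t), (i + 1)) := by
  have hx1 : x < 1 := by linarith
  obtain ⟨k, rfl⟩ := Nat.exists_eq_add_of_le ht
  rw [Nat.add_sub_cancel_left]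
  set f : ℕ → ℝ := fun j => |(x ^ r - x ^ j) / (x ^ t - x ^ j)| with hf
  have hlt : ∀ {i j : ℕ}, i < j → x ^ j < x ^ i := fun h => pow_lt_pow_right_of_lt_one₀ hx0 hx1 h
  -- The product is split into j = n, j < t and t < j ≤ m. These contribute at most x^(r-t), the
  -- constant 4, and 4 times the product of the x^(j-t).
  have h1 : |interpWeight x (t + k) r n t| =
      f n * ((∏ i ∈ Finset.range t, f i) * ∏ i ∈ Finset.range k, f (t + (i + 1))) := by
    rw [interpWeight, Finset.abs_prod, Finset.erase_insert_of_ne (by omega),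
      Finset.prod_insert (by simp; omega)]
    congr 1
    -- Setting the factor at t to 1 turns the product over the erased set into one over a full
    -- range, which can be split.
    have h2 : ∀ j ∈ (Finset.range (t + k + 1)).erase t, f j = Function.update f t 1 j :=
      fun j hj => (Function.update_of_ne (Finset.ne_of_mem_erase hj) _ _).symm
    rw [Finset.prod_congr rfl h2, Finset.prod_erase (a := t) (f := Function.update f t 1) _
      (Function.update_self t 1 f), add_assoc,
      Finset.prod_range_add, Finset.prod_range_succ', Nat.add_zero, Function.update_self, mul_one]
    congr 1
    · refine Finset.prod_congr rfl fun i hi => Function.update_of_ne ?_ _ _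
      exact (Finset.mem_range.1 hi).ne
    · exact Finset.prod_congr rfl fun i _ => Function.update_of_ne (by omega) _ _
  have hn : f n ≤ x ^ (r - t) := by
    have h3 := hlt (show t < n by omega)
    have h4 := hlt hrn
    have h5 : x ^ r = x ^ (r - t) * x ^ t := by rw [← pow_add]; congr 1; omega
    have h6 : x ^ (r - t) ≤ 1 := pow_le_one₀ hx0.le hx1.le
    have h7 : 0 < x ^ n := by positivity
    rw [hf]
    beta_reduce
    rw [abs_of_nonneg (div_nonneg (by linarith) (by linarith)), div_le_iff₀ (by linarith), h5]
    nlinarith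
  have hlow : ∏ i ∈ Finset.range t, f i ≤ 4 := by
    refine le_trans (Finset.prod_le_prod (fun i _ => abs_nonneg _) (g := fun i =>
      (1 - x ^ (t - 1 - i + 1))⁻¹) fun i hi => ?_) ?_
    · have hi' := Finset.mem_range.1 hi
      have h3 := hlt hi'
      have h4 := hlt (show i < r by omega)
      have h5 : x ^ t = x ^ i * x ^ (t - 1 - i + 1) := by rw [← pow_add]; congr 1; omega
      have h7 : 0 < x ^ r := by positivity
      have h8 : 0 < x ^ i := by positivity
      have h9 : 0 < 1 - x ^ (t - 1 - i + 1) := sub_pos.2 (pow_lt_one₀ hx0.le hx1 (by omega))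
      rw [hf]
      beta_reduce
      rw [abs_div, abs_of_neg (by linarith), abs_of_neg (by linarith), div_le_iff₀ (by linarith),
        h5]
      have h10 : (1 - x ^ (t - 1 - i + 1))⁻¹ * -(x ^ i * x ^ (t - 1 - i + 1) - x ^ i) = x ^ i := by
        field_simp
        ring
      rw [h10]
      linarith
    · rw [Finset.prod_range_reflect (fun i => (1 - x ^ (i + 1))⁻¹)]
      exact prod_range_inv_one_sub_pow_le hx0 hx t
  have hhigh : ∏ i ∈ Finset.range k, f (t + (i + 1)) ≤
      4 * x ^ ∑ i ∈ Finset.range k, (i + 1) := by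
    refine le_trans (Finset.prod_le_prod (fun i _ => abs_nonneg _) (g := fun i =>
      (1 - x ^ (i + 1))⁻¹ * x ^ (i + 1)) fun i hi => ?_) ?_
    · have hi' := Finset.mem_range.1 hi
      have h3 := hlt (show t < t + (i + 1) by omega)
      have h4 := hlt (show t + (i + 1) < r by omega)
      have h5 : 0 < 1 - x ^ (i + 1) := sub_pos.2 (pow_lt_one₀ hx0.le hx1 (by omega))
      have h7 : 0 < x ^ r := by positivity
      have h8 : 0 < x ^ t := by positivity
      rw [hf]
      beta_reduce
      rw [abs_div, abs_of_neg (by linarith), abs_of_pos (by linarith), div_le_iff₀ (by linarith),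
        pow_add x t]
      have h9 : (1 - x ^ (i + 1))⁻¹ * x ^ (i + 1) * (x ^ t - x ^ t * x ^ (i + 1)) =
          x ^ t * x ^ (i + 1) := by
        field_simp
      rw [h9]
      linarith
    · rw [Finset.prod_mul_distrib, Finset.prod_pow_eq_pow_sum]
      exact mul_le_mul_of_nonneg_right (prod_range_inv_one_sub_pow_le hx0 hx k) (by positivity)
  rw [h1, pow_add]
  calc f n * ((∏ i ∈ Finset.range t, f i) * ∏ i ∈ Finset.range k, f (t + (i + 1)))
      ≤ x ^ (r - t) * (4 * (4 * x ^ ∑ i ∈ Finset.range k, (i + 1))) := by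
        refine mul_le_mul hn (mul_le_mul hlow hhigh ?_ (by norm_num)) ?_ (by positivity)
        · exact Finset.prod_nonneg fun i _ => abs_nonneg _
        · exact mul_nonneg (Finset.prod_nonneg fun i _ => abs_nonneg _)
            (Finset.prod_nonneg fun i _ => abs_nonneg _)
    _ = _ := by ring

lemma sum_range_pow_sub_le_two (hx0 : 0 ≤ x) (hx : x ≤ 1 / 2) (m : ℕ) :
    ∑ t ∈ Finset.range (m + 1), x ^ (m - t) ≤ 2 := by
  have h1 : ∑ t ∈ Finset.range (m + 1), x ^ (m - t) = ∑ t ∈ Finset.range (m + 1), x ^ t := by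
    rw [← Finset.sum_range_reflect]
    refine Finset.sum_congr rfl fun t ht => ?_
    have := Finset.mem_range.1 ht
    congr 1
    omega
  rw [h1]
  have h2 : ∀ k, ∑ t ∈ Finset.range k, x ^ t ≤ 2 * (1 - x ^ k) := by
    intro k
    induction k with
    | zero => simp
    | succ k ih =>
      rw [Finset.sum_range_succ, pow_succ]
      nlinarith [pow_nonneg hx0 k]
  refine (h2 _).trans ?_
  have := pow_nonneg hx0 (m + 1)
  linarith

lemma two_mul_sum_range_succ (k : ℕ) : 2 * ∑ i ∈ Finset.range k, (i + 1) = k * (k + 1) := by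
  induction k with
  | zero => simp
  | succ k ih => rw [Finset.sum_range_succ, mul_add, ih]; ring

end InterpolationWeights

/-! ### The dual witness and its Fourier coefficients. -/

section Witness

variable {F : Type u} [Field F] [Fintype F] {n m r : ℕ} {a : F} {ψ : AddChar F ℂ}

/-- The interpolation weight for the nodes `q ^ (-j)`, `j ∈ {0, …, m, n}`, at `q ^ (-r)`. -/
noncomputable def fieldWeight (F : Type u) [Fintype F] (m r n t : ℕ) : ℝ :=
  interpWeight (Fintype.card F : ℝ)⁻¹ m r n t

/-- The dual witness: rank `r` against determinant `a`, corrected by small multiples of the laws of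
rank at most `m`. -/
noncomputable def rankDetWitness (m r : ℕ) (a : F) (Z : Matrix (Fin n) (Fin n) F) : ℝ :=
  rankLaw F n r Z - ∑ t ∈ Finset.range (m + 1), fieldWeight F m r n t * rankLaw F n t Z -
    fieldWeight F m r n n * detLaw n a Z

lemma rankLaw_mul_comp_rank {t : ℕ} (g : ℕ → ℝ) (Z : Matrix (Fin n) (Fin n) F) :
    rankLaw F n t Z * g Z.rank = rankLaw F n t Z * g t := by
  by_cases h : rankLaw F n t Z = 0
  · rw [h, zero_mul, zero_mul]
  · rw [rank_eq_of_rankLaw_ne_zero h]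

lemma rank_eq_of_detLaw_ne_zero (ha : a ≠ 0) {Z : Matrix (Fin n) (Fin n) F}
    (h : detLaw n a Z ≠ 0) : Z.rank = n := by
  have h1 : Z.det ≠ 0 := by rwa [det_eq_of_detLaw_ne_zero h]
  rw [Matrix.rank_of_det_ne_zero h1, Fintype.card_fin]

lemma detLaw_mul_comp_rank (ha : a ≠ 0) (g : ℕ → ℝ) (Z : Matrix (Fin n) (Fin n) F) :
    detLaw n a Z * g Z.rank = detLaw n a Z * g n := by
  by_cases h : detLaw n a Z = 0
  · rw [h, zero_mul, zero_mul]
  · rw [rank_eq_of_detLaw_ne_zero ha h]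

/-- Every law in the witness is supported on a single rank, with determinant a counting as rank n,
so a function of the rank sees only the weights. -/
lemma sum_rankDetWitness_mul_comp_rank (hmr : m < r) (hrn : r < n) (ha : a ≠ 0) (g : ℕ → ℝ) :
    ∑ Z : Matrix (Fin n) (Fin n) F, rankDetWitness m r a Z * g Z.rank =
      g r - ∑ t ∈ insert n (Finset.range (m + 1)), fieldWeight F m r n t * g t := by
  have h1 : ∀ Z : Matrix (Fin n) (Fin n) F, rankDetWitness m r a Z * g Z.rank =
      rankLaw F n r Z * g r - ∑ t ∈ Finset.range (m + 1),
        fieldWeight F m r n t * g t * rankLaw F n t Z -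
        fieldWeight F m r n n * g n * detLaw n a Z := by
    intro Z
    rw [rankDetWitness, sub_mul, sub_mul, rankLaw_mul_comp_rank, mul_assoc _ (detLaw n a Z),
      detLaw_mul_comp_rank ha, Finset.sum_mul]
    congr 1
    · congr 1
      refine Finset.sum_congr rfl fun t _ => ?_
      rw [mul_assoc, rankLaw_mul_comp_rank]
      ring
    · ring
  simp only [h1]
  rw [Finset.sum_sub_distrib, Finset.sum_sub_distrib, ← Finset.sum_mul, sum_rankLaw hrn.le,
    ← Finset.mul_sum, sum_detLaw (by omega), Finset.sum_comm,
    Finset.sum_insert (by simp; omega)]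
  have h2 : ∑ t ∈ Finset.range (m + 1), ∑ Z : Matrix (Fin n) (Fin n) F,
      fieldWeight F m r n t * g t * rankLaw F n t Z =
      ∑ t ∈ Finset.range (m + 1), fieldWeight F m r n t * g t := by
    refine Finset.sum_congr rfl fun t ht => ?_
    have := Finset.mem_range.1 ht
    rw [← Finset.mul_sum, sum_rankLaw (by omega), mul_one]
  rw [h2]
  ring

lemma sum_rankDetWitness_mul_pow_rank (hmr : m < r) (hrn : r < n) (ha : a ≠ 0) {j : ℕ}
    (hj : j ≤ m + 1) :
    ∑ Z : Matrix (Fin n) (Fin n) F,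
      rankDetWitness m r a Z * ((Fintype.card F : ℝ)⁻¹ ^ j) ^ Z.rank = 0 := by
  rw [sum_rankDetWitness_mul_comp_rank hmr hrn ha (fun t => ((Fintype.card F : ℝ)⁻¹ ^ j) ^ t)]
  have h := inv_card_le_half F
  rw [sub_eq_zero]
  exact (sum_interpWeight_mul_pow (inv_card_pos F) (by linarith) (by omega) hj).symm

lemma sum_rankDetWitness (hmr : m < r) (hrn : r < n) (ha : a ≠ 0) :
    ∑ Z : Matrix (Fin n) (Fin n) F, rankDetWitness m r a Z = 0 := by
  simpa using sum_rankDetWitness_mul_pow_rank hmr hrn ha (Nat.zero_le (m + 1))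

lemma matrixFourier_rankDetWitness (M : Matrix (Fin n) (Fin n) F) :
    matrixFourier ψ (fun Z => (rankDetWitness m r a Z : ℂ)) M =
      matrixFourier ψ (fun Z => (rankLaw F n r Z : ℂ)) M -
      ∑ t ∈ Finset.range (m + 1), (fieldWeight F m r n t : ℂ) *
        matrixFourier ψ (fun Z => (rankLaw F n t Z : ℂ)) M -
      fieldWeight F m r n n * matrixFourier ψ (fun Z => (detLaw n a Z : ℂ)) M := by
  simp only [matrixFourier, rankDetWitness]
  push_cast
  simp only [sub_mul, Finset.sum_sub_distrib, Finset.sum_mul, Finset.mul_sum, mul_assoc]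
  congr 2
  exact Finset.sum_comm

lemma matrixFourier_rankDetWitness_eq_zero (hψ : ψ.IsPrimitive) (hmr : m < r) (hrn : r < n)
    (ha : a ≠ 0) {M : Matrix (Fin n) (Fin n) F} (hM : M.rank ≤ m + 1) :
    matrixFourier ψ (fun Z => (rankDetWitness m r a Z : ℂ)) M = 0 := by
  refine matrixFourier_eq_zero_of_rank_le hψ (d := m + 1) (by omega) (fun N N' hN hNN' => ?_)
    (fun j hj => ?_) M hM
  -- Determinant one is needed because `detLaw` is not GL-invariant; it is available since m + 1 ≤ r
  -- < n.
  · obtain ⟨G, H, hG, hH, rfl⟩ :=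
      Matrix.exists_mul_mul_eq_of_rank_eq_of_lt hNN' (by omega)
    simp only [matrixFourier_rankDetWitness, matrixFourier_rankLaw_equivalent _ hG hH,
      matrixFourier_detLaw_equivalent _ _ hG hH]
  · have h := sum_rankDetWitness_mul_pow_rank (F := F) (n := n) hmr hrn ha hj
    exact_mod_cast congrArg (fun z : ℝ => (z : ℂ)) h

lemma sqrt_inv_pow_eq_rpow {q : ℝ} (hq : 0 < q) (k : ℕ) : √q⁻¹ ^ k = q ^ (-(k : ℝ) / 2) := by
  rw [Real.sqrt_eq_rpow, ← Real.rpow_natCast, ← Real.rpow_mul (inv_nonneg.2 hq.le),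
    Real.inv_rpow hq.le, ← Real.rpow_neg hq.le]
  congr 1
  ring

lemma inv_pow_eq_rpow {q : ℝ} (hq : 0 < q) (k : ℕ) : q⁻¹ ^ k = q ^ (-(k : ℝ)) := by
  rw [inv_pow, Real.rpow_neg hq.le, Real.rpow_natCast]

/-- The order of magnitude of the Fourier coefficients of the witness. -/
noncomputable def witnessDecay (q : ℝ) (r : ℕ) : ℝ := q ^ (-((r : ℝ) / 3 + (r : ℝ) ^ 2 / 16))

lemma sqrt_inv_pow_mul_le_witnessDecay {q : ℝ} (hq : 1 ≤ q) {s : ℕ} (hm : r ≤ 2 * m + 1)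
    (hs : m + 2 ≤ s) : √q⁻¹ ^ (r * s) ≤ witnessDecay q r := by
  rw [sqrt_inv_pow_eq_rpow (by linarith), witnessDecay]
  refine Real.rpow_le_rpow_of_exponent_le hq ?_
  have hm' : (r : ℝ) ≤ 2 * m + 1 := by exact_mod_cast hm
  have hs' : (m : ℝ) + 2 ≤ s := by exact_mod_cast hs
  have hr : (0 : ℝ) ≤ r := Nat.cast_nonneg r
  push_cast
  nlinarith

/-- The factor q comes from the density 1/q of a determinant fibre. It is paid for by n ≥ r + 1,
which gains at least (m + 2)/2 ≥ 1 in the exponent. -/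
lemma mul_sqrt_inv_pow_mul_le_witnessDecay {q : ℝ} (hq : 1 ≤ q) {s : ℕ} (hm : r ≤ 2 * m + 1)
    (hs : m + 2 ≤ s) (hrn : r < n) : q * √q⁻¹ ^ (n * s) ≤ witnessDecay q r := by
  have hq0 : 0 < q := by linarith
  rw [sqrt_inv_pow_eq_rpow hq0, witnessDecay]
  conv_lhs => rw [← Real.rpow_one q, ← Real.rpow_mul hq0.le, one_mul, ← Real.rpow_add hq0]
  refine Real.rpow_le_rpow_of_exponent_le hq ?_
  have hm' : (r : ℝ) ≤ 2 * m + 1 := by exact_mod_cast hm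
  have hs' : (m : ℝ) + 2 ≤ s := by exact_mod_cast hs
  have hn' : (r : ℝ) + 1 ≤ n := by exact_mod_cast hrn
  have hr : (0 : ℝ) ≤ r := Nat.cast_nonneg r
  have hm0 : (0 : ℝ) ≤ m := Nat.cast_nonneg m
  have h1 : ((r : ℝ) + 1) * (m + 2) ≤ n * s := by gcongr
  push_cast
  nlinarith

/-- The size of the weight times the Fourier decay of rank t. The spare factor q^(-(m-t)) makes the
sum over t geometric. -/
lemma inv_pow_mul_sqrt_inv_pow_le {q : ℝ} (hq : 1 ≤ q) {s t : ℕ} (hm : r ≤ 2 * m + 1)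
    (hm2 : 2 * m ≤ r) (hr : 1 ≤ r) (hs : m + 2 ≤ s) (ht : t ≤ m) :
    q⁻¹ ^ (r - t + ∑ i ∈ Finset.range (m - t), (i + 1)) * √q⁻¹ ^ (t * s) ≤
      witnessDecay q r * q⁻¹ ^ (m - t) := by
  have hq0 : 0 < q := by linarith
  obtain ⟨k, rfl⟩ := Nat.exists_eq_add_of_le ht
  rw [sqrt_inv_pow_eq_rpow hq0, witnessDecay, inv_pow_eq_rpow hq0, inv_pow_eq_rpow hq0,
    ← Real.rpow_add hq0, ← Real.rpow_add hq0]
  refine Real.rpow_le_rpow_of_exponent_le hq ?_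
  rw [Nat.add_sub_cancel_left]
  have h1 : 2 * ((∑ i ∈ Finset.range k, (i + 1) : ℕ) : ℝ) = k * (k + 1) := by
    exact_mod_cast two_mul_sum_range_succ k
  have h2 : ((r - t : ℕ) : ℝ) = r - t := Nat.cast_sub (by omega)
  rw [Nat.cast_add, h2, Nat.cast_mul]
  generalize ((∑ i ∈ Finset.range k, (i + 1) : ℕ) : ℝ) = σ at h1 ⊢
  have hm' : (r : ℝ) ≤ 2 * (t + k) + 1 := by exact_mod_cast hm
  have hm2' : 2 * ((t : ℝ) + k) ≤ r := by exact_mod_cast hm2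
  have hs' : (t : ℝ) + k + 2 ≤ s := by exact_mod_cast hs
  have hr' : (1 : ℝ) ≤ r := by exact_mod_cast hr
  have ht0 : (0 : ℝ) ≤ t := Nat.cast_nonneg t
  have hk0 : (0 : ℝ) ≤ k := Nat.cast_nonneg k
  have h3 : (t : ℝ) * (t + k + 2) ≤ t * s := by gcongr
  have h4 : ((r : ℝ) - 1) ^ 2 ≤ (2 * (t + k)) ^ 2 := by
    apply pow_le_pow_left₀ <;> linarith
  -- With s ≥ t + k + 2, the term ts/2 contains a t that cancels the one in r - t. What remains is
  -- at least r + (k² + kt + t² + k)/2, and k² + kt + t² ≥ 3(k + t)²/4 with 2(k + t) ≥ r - 1.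
  nlinarith [sq_nonneg ((k : ℝ) - t), sq_nonneg ((r : ℝ) - 1)]

/-- Away from the ranks where they vanish, the Fourier coefficients of the witness are
`q ^ (-Ω(r²))`. -/
theorem norm_matrixFourier_rankDetWitness_le (hψ : ψ.IsPrimitive) (hm : r ≤ 2 * m + 1)
    (hm2 : 2 * m ≤ r) (hr : 1 ≤ r) (hrn : r < n) (ha : a ≠ 0) (M : Matrix (Fin n) (Fin n) F) :
    ‖matrixFourier ψ (fun Z => (rankDetWitness m r a Z : ℂ)) M‖ ≤
      136 * witnessDecay (Fintype.card F) r := by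
  have hq : (1 : ℝ) ≤ Fintype.card F := by exact_mod_cast Fintype.card_pos
  have hx0 := inv_card_pos F
  have hx := inv_card_le_half F
  have hρ : 0 ≤ witnessDecay (Fintype.card F) r := by
    rw [witnessDecay]
    positivity
  rcases le_or_gt M.rank (m + 1) with hM | hM
  · rw [matrixFourier_rankDetWitness_eq_zero hψ (by omega) hrn ha hM, norm_zero]
    positivity
  set ρ := witnessDecay (Fintype.card F) r with hρdef
  have h1 : ‖matrixFourier ψ (fun Z => (rankLaw F n r Z : ℂ)) M‖ ≤ 4 * ρ :=
    (norm_matrixFourier_rankLaw_le hψ hrn.le M).trans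
      (mul_le_mul_of_nonneg_left (sqrt_inv_pow_mul_le_witnessDecay hq hm hM) (by norm_num))
  have h2 : ‖(fieldWeight F m r n n : ℂ) * matrixFourier ψ (fun Z => (detLaw n a Z : ℂ)) M‖ ≤
      4 * ρ := by
    have hw : fieldWeight F m r n n ∈ Set.Icc (0 : ℝ) 1 :=
      interpWeight_last_mem_Icc hx0 (by linarith) (by omega) hrn
    rw [norm_mul, Complex.norm_real, Real.norm_of_nonneg hw.1]
    refine (mul_le_of_le_one_left (norm_nonneg _) hw.2).trans ?_
    refine (norm_matrixFourier_detLaw_le hψ (by omega) ha M).trans ?_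
    rw [mul_assoc]
    exact mul_le_mul_of_nonneg_left (mul_sqrt_inv_pow_mul_le_witnessDecay hq hm hM hrn)
      (by norm_num)
  have h3 : ‖∑ t ∈ Finset.range (m + 1), (fieldWeight F m r n t : ℂ) *
      matrixFourier ψ (fun Z => (rankLaw F n t Z : ℂ)) M‖ ≤ 128 * ρ := by
    -- 64 is 16 from the weight times 4 from the law; the geometric sum doubles it.
    calc _ ≤ ∑ t ∈ Finset.range (m + 1), 64 * ρ * (Fintype.card F : ℝ)⁻¹ ^ (m - t) := by
          refine (norm_sum_le _ _).trans (Finset.sum_le_sum fun t ht => ?_)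
          have ht' : t ≤ m := Finset.mem_range_succ_iff.1 ht
          rw [norm_mul, Complex.norm_real, Real.norm_eq_abs]
          have h4 := abs_interpWeight_le hx0 hx ht' (by omega) hrn
          have h5 := norm_matrixFourier_rankLaw_le hψ (t := t) (by omega) M
          have h6 := inv_pow_mul_sqrt_inv_pow_le hq hm hm2 hr hM ht'
          rw [← hρdef] at h6
          refine (mul_le_mul h4 h5 (norm_nonneg _) (by positivity)).trans ?_
          linarith
      _ ≤ 64 * ρ * 2 := by
          rw [← Finset.mul_sum]
          exact mul_le_mul_of_nonneg_left (sum_range_pow_sub_le_two hx0.le hx m) (by positivity)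
      _ = 128 * ρ := by ring
  rw [matrixFourier_rankDetWitness]
  refine (norm_sub_le _ _).trans ((add_le_add (norm_sub_le _ _) le_rfl).trans ?_)
  linarith

/-- The total mass of the correction terms of the witness. -/
lemma sum_abs_fieldWeight_le (hmr : m < r) (hrn : r < n) :
    ∑ t ∈ Finset.range (m + 1), |fieldWeight F m r n t| ≤
      32 * (Fintype.card F : ℝ)⁻¹ ^ (r - m) := by
  have hx0 := inv_card_pos F
  have hx := inv_card_le_half F
  set x := (Fintype.card F : ℝ)⁻¹ with hxdef
  calc _ ≤ ∑ t ∈ Finset.range (m + 1), 16 * x ^ (r - m) * x ^ (m - t) := by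
        refine Finset.sum_le_sum fun t ht => ?_
        have ht' : t ≤ m := Finset.mem_range_succ_iff.1 ht
        refine (abs_interpWeight_le hx0 hx ht' hmr hrn).trans ?_
        rw [mul_assoc, ← pow_add]
        refine mul_le_mul_of_nonneg_left ?_ (by norm_num)
        exact pow_le_pow_of_le_one hx0.le (by linarith) (by omega)
    _ ≤ 16 * x ^ (r - m) * 2 := by
        rw [← Finset.mul_sum]
        exact mul_le_mul_of_nonneg_left (sum_range_pow_sub_le_two hx0.le hx m) (by positivity)
    _ = _ := by ring

end Witness

/-! ### From the witness to the communication bound. -/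

section LowerBound

variable {F : Type u} [Field F] {n m r : ℕ} {a : F} {ε : ℝ}

lemma one_sub_le_accept {p : QuantumProtocol (Matrix (Fin n) (Fin n) F) (Matrix (Fin n) (Fin n) F)}
    (hp : p.Computes ε (rankDet F n r a)) {A B : Matrix (Fin n) (Fin n) F}
    (h : (A + B).rank = r) : 1 - ε ≤ p.accept A B := by
  have h1 := hp A B (-1) (by simp [rankDet, h])
  rwa [QuantumProtocol.outputProb, if_pos rfl] at h1

lemma accept_le {p : QuantumProtocol (Matrix (Fin n) (Fin n) F) (Matrix (Fin n) (Fin n) F)}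
    (hp : p.Computes ε (rankDet F n r a)) (hrn : r < n) (ha : a ≠ 0)
    {A B : Matrix (Fin n) (Fin n) F} (h : (A + B).det = a) : p.accept A B ≤ ε := by
  have h0 : (A + B).rank = n := by
    rw [Matrix.rank_of_det_ne_zero (h ▸ ha), Fintype.card_fin]
  have h1 := hp A B 1 (by simp [rankDet, h0, hrn.ne', h])
  rw [QuantumProtocol.outputProb, if_neg (by decide)] at h1
  have h2 : p.accept A B = p.steps.probNegOne A B p.shared := rfl
  linarith

variable [Fintype F]

lemma exists_rank_eq (hrn : r ≤ n) : ∃ Z : Matrix (Fin n) (Fin n) F, Z.rank = r := by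
  obtain ⟨P, hP⟩ := fullRankTall_nonempty (F := F) hrn
  obtain ⟨Q, hQ⟩ := fullRankWide_nonempty (F := F) hrn
  exact ⟨P * Q, by
    rw [Matrix.rank_mul_eq_of_rank_eq_width (mem_fullRankTall.1 hP), mem_fullRankWide.1 hQ]⟩

/-- Without communication the output cannot depend on both inputs. -/
lemma one_le_cost {p : QuantumProtocol (Matrix (Fin n) (Fin n) F) (Matrix (Fin n) (Fin n) F)}
    (hp : p.Computes ε (rankDet F n r a)) (hε : ε < 1 / 2) (hrn : r < n) (ha : a ≠ 0) :
    1 ≤ p.cost := by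
  obtain ⟨Z, hZ⟩ := exists_rank_eq (F := F) hrn.le
  obtain ⟨W, hW⟩ := exists_det_eq (F := F) (n := n) (by omega) a
  -- Without messages the output depends on one party's input only. Fixing the other input at 0 or
  -- this one at 0 covers both possible speakers.
  have h1 : 1 - ε ≤ p.accept 0 Z := one_sub_le_accept hp (by rwa [zero_add])
  have h2 : p.accept 0 W ≤ ε := accept_le hp hrn ha (by rwa [zero_add])
  have h3 : 1 - ε ≤ p.accept Z 0 := one_sub_le_accept hp (by rwa [add_zero])
  have h4 : p.accept W 0 ≤ ε := accept_le hp hrn ha (by rwa [add_zero])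
  by_contra h0
  obtain ⟨da, db, ψ, hψ, S⟩ := p
  cases S with
  | aliceOutput P hP =>
    have h5 := h1.trans h2
    linarith
  | bobOutput P hP =>
    have h5 := h3.trans h4
    linarith
  | aliceSends a' U hU next => exact h0 (Nat.succ_le_succ (Nat.zero_le _))
  | bobSends b' V hV next => exact h0 (Nat.succ_le_succ (Nat.zero_le _))

/-- Rank r gains the advantage 1 - 2ε, and determinant a contributes with the right sign. At ranks t
≤ m nothing is promised, so only |2 · accept - 1| ≤ 1 is used. -/
lemma rankDetWitness_mul_le {p : QuantumProtocol (Matrix (Fin n) (Fin n) F)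
    (Matrix (Fin n) (Fin n) F)} (hp : p.Computes ε (rankDet F n r a)) (hε : ε ≤ 1 / 2)
    (hmr : m < r) (hrn : r < n) (ha : a ≠ 0) (A B : Matrix (Fin n) (Fin n) F) :
    (1 - 2 * ε) * rankLaw F n r (A + B) -
      ∑ t ∈ Finset.range (m + 1), |fieldWeight F m r n t| * rankLaw F n t (A + B) ≤
      rankDetWitness m r a (A + B) * (2 * p.accept A B - 1) := by
  have hx0 := inv_card_pos F
  have hx := inv_card_le_half F
  have hw : fieldWeight F m r n n ∈ Set.Icc (0 : ℝ) 1 :=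
    interpWeight_last_mem_Icc hx0 (by linarith) hmr hrn
  have h1 : (1 - 2 * ε) * rankLaw F n r (A + B) ≤
      rankLaw F n r (A + B) * (2 * p.accept A B - 1) := by
    by_cases h : rankLaw F n r (A + B) = 0
    · rw [h, mul_zero, zero_mul]
    · have h2 := one_sub_le_accept hp (rank_eq_of_rankLaw_ne_zero h)
      rw [mul_comm]
      exact mul_le_mul_of_nonneg_left (by linarith) (productLaw_nonneg _)
  have h2 : fieldWeight F m r n n * detLaw n a (A + B) * (2 * p.accept A B - 1) ≤ 0 := by
    by_cases h : detLaw n a (A + B) = 0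
    · rw [h, mul_zero, zero_mul]
    · have h3 := accept_le hp hrn ha (det_eq_of_detLaw_ne_zero h)
      exact mul_nonpos_of_nonneg_of_nonpos (mul_nonneg hw.1 (productLaw_nonneg _)) (by linarith)
  have h3 : (∑ t ∈ Finset.range (m + 1), fieldWeight F m r n t * rankLaw F n t (A + B)) *
      (2 * p.accept A B - 1) ≤
      ∑ t ∈ Finset.range (m + 1), |fieldWeight F m r n t| * rankLaw F n t (A + B) := by
    rw [Finset.sum_mul]
    refine Finset.sum_le_sum fun t _ => ?_
    have h4 : |2 * p.accept A B - 1| ≤ 1 := by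
      rw [abs_le]
      constructor <;> linarith [p.accept_nonneg A B, p.accept_le_one A B]
    have h5 : 0 ≤ rankLaw F n t (A + B) := productLaw_nonneg _
    refine (le_abs_self _).trans ?_
    rw [abs_mul, abs_mul, abs_of_nonneg h5]
    exact mul_le_of_le_one_right (by positivity) h4
  rw [rankDetWitness, sub_mul, sub_mul]
  linarith

/-- The tradeoff between communication and error. -/
theorem advantage_le_of_computes {p : QuantumProtocol (Matrix (Fin n) (Fin n) F)
    (Matrix (Fin n) (Fin n) F)} (hp : p.Computes ε (rankDet F n r a)) (hε : ε ≤ 1 / 2)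
    (hm : r ≤ 2 * m + 1) (hm2 : 2 * m ≤ r) (hr : 1 ≤ r) (hrn : r < n) (ha : a ≠ 0) :
    1 - 2 * ε - 32 * (Fintype.card F : ℝ)⁻¹ ^ (r - m) ≤
      272 * 4 ^ p.cost * witnessDecay (Fintype.card F) r := by
  have hmr : m < r := by omega
  obtain ⟨ψ, hψ⟩ := exists_isPrimitive_addChar_complex F
  set G : ℝ := (Fintype.card (Matrix (Fin n) (Fin n) F) : ℝ) with hG
  have hG0 : 0 < G := by
    rw [hG]
    exact_mod_cast Fintype.card_pos
  set Φ : Matrix (Fin n) (Fin n) F → ℝ := rankDetWitness m r a with hΦ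
  have hshift : ∀ g : Matrix (Fin n) (Fin n) F → ℝ, ∑ A, ∑ B, g (A + B) = G * ∑ Z, g Z := by
    intro g
    have h : ∀ A, ∑ B, g (A + B) = ∑ Z, g Z := fun A => Equiv.sum_comp (Equiv.addLeft A) g
    simp only [h, Finset.sum_const, Finset.card_univ, nsmul_eq_mul]
    rfl
  have hρ : 0 ≤ witnessDecay (Fintype.card F) r := by
    rw [witnessDecay]
    positivity
  have hup : ‖∑ A, ∑ B, (Φ (A + B) : ℂ) * (p.accept A B : ℂ)‖ ≤
      4 ^ p.cost * (136 * witnessDecay (Fintype.card F) r * G) := by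
    have h := p.norm_sum_mul_accept_le (K := fun A B => (Φ (A + B) : ℂ))
      (N := 136 * witnessDecay (Fintype.card F) r) (by positivity)
      (norm_sum_add_mul_le hψ (Φ := fun Z => (Φ Z : ℂ)) (by positivity)
        (norm_matrixFourier_rankDetWitness_le hψ hm hm2 hr hrn ha))
    rwa [← hG, Real.mul_self_sqrt hG0.le] at h
  have hup2 : ∑ A, ∑ B, Φ (A + B) * p.accept A B ≤
      4 ^ p.cost * (136 * witnessDecay (Fintype.card F) r * G) := by
    refine (le_abs_self _).trans ?_
    rw [← Real.norm_eq_abs, ← Complex.norm_real]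
    push_cast
    exact hup
  have hlow : ∑ A, ∑ B, ((1 - 2 * ε) * rankLaw F n r (A + B) -
      ∑ t ∈ Finset.range (m + 1), |fieldWeight F m r n t| * rankLaw F n t (A + B)) ≤
      ∑ A, ∑ B, Φ (A + B) * (2 * p.accept A B - 1) :=
    Finset.sum_le_sum fun A _ => Finset.sum_le_sum fun B _ =>
      rankDetWitness_mul_le hp hε hmr hrn ha A B
  -- The witness has total mass zero, so the constant -1 drops out; the factor 2 turns 136 into 272.
  have hsplit : ∑ A, ∑ B, Φ (A + B) * (2 * p.accept A B - 1) =
      2 * ∑ A, ∑ B, Φ (A + B) * p.accept A B := by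
    have h := hshift Φ
    rw [hΦ, sum_rankDetWitness hmr hrn ha, mul_zero, ← hΦ] at h
    have h2 : ∀ A B, Φ (A + B) * (2 * p.accept A B - 1) =
        2 * (Φ (A + B) * p.accept A B) - Φ (A + B) := fun A B => by ring
    simp only [h2, Finset.sum_sub_distrib, h, sub_zero, Finset.mul_sum]
  rw [hsplit, hshift (fun Z => (1 - 2 * ε) * rankLaw F n r Z -
    ∑ t ∈ Finset.range (m + 1), |fieldWeight F m r n t| * rankLaw F n t Z)] at hlow
  have hsum : ∑ Z, ((1 - 2 * ε) * rankLaw F n r Z -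
      ∑ t ∈ Finset.range (m + 1), |fieldWeight F m r n t| * rankLaw F n t Z) =
      1 - 2 * ε - ∑ t ∈ Finset.range (m + 1), |fieldWeight F m r n t| := by
    rw [Finset.sum_sub_distrib, ← Finset.mul_sum, sum_rankLaw hrn.le, mul_one, Finset.sum_comm]
    congr 1
    refine Finset.sum_congr rfl fun t ht => ?_
    have := Finset.mem_range.1 ht
    rw [← Finset.mul_sum, sum_rankLaw (by omega), mul_one]
  rw [hsum] at hlow
  have hmass := sum_abs_fieldWeight_le (F := F) hmr hrn
  have hfin : G * (1 - 2 * ε - 32 * (Fintype.card F : ℝ)⁻¹ ^ (r - m)) ≤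
      G * (272 * 4 ^ p.cost * witnessDecay (Fintype.card F) r) := by
    have h1 : G * (1 - 2 * ε - 32 * (Fintype.card F : ℝ)⁻¹ ^ (r - m)) ≤
        G * (1 - 2 * ε - ∑ t ∈ Finset.range (m + 1), |fieldWeight F m r n t|) :=
      mul_le_mul_of_nonneg_left (by linarith) hG0.le
    linarith
  exact le_of_mul_le_mul_left hfin hG0

lemma error_lt_half {q : ℝ} (hq : 0 < q) (r : ℕ) :
    1 / 2 - 1 / (4 * q ^ ((r : ℝ) / 3)) < 1 / 2 := by
  have : 0 < 1 / (4 * q ^ ((r : ℝ) / 3)) := by positivity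
  linarith

/-- The lower bound for a single protocol. -/
theorem le_mul_cost_of_computes {p : QuantumProtocol (Matrix (Fin n) (Fin n) F)
    (Matrix (Fin n) (Fin n) F)}
    (hp : p.Computes (1 / 2 - 1 / (4 * (Fintype.card F : ℝ) ^ ((r : ℝ) / 3))) (rankDet F n r a))
    (hrn : r < n) (ha : a ≠ 0) :
    1 + (r : ℝ) ^ 2 * Real.logb 2 (Fintype.card F) ≤ 1765 * p.cost := by
  have hq2 : (2 : ℝ) ≤ Fintype.card F := by exact_mod_cast Fintype.one_lt_card (α := F)
  set q : ℝ := (Fintype.card F : ℝ) with hqdef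
  have hq0 : 0 < q := by linarith
  have hT : (1 : ℝ) ≤ p.cost := by
    exact_mod_cast one_le_cost hp (error_lt_half hq0 r) hrn ha
  set ℓ : ℝ := Real.logb 2 q with hℓ
  have hqℓ : q = 2 ^ ℓ := (Real.rpow_logb (by norm_num) (by norm_num) hq0).symm
  have hℓ1 : 1 ≤ ℓ := by
    rw [hℓ, Real.le_logb_iff_rpow_le (by norm_num) hq0, Real.rpow_one]
    exact hq2
  have hr0 : (0 : ℝ) ≤ r := Nat.cast_nonneg r
  -- The threshold 42 = 6 · 7 makes q^(r/6) at least 2^7 = 128, as needed to absorb the factor 32 of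
  -- the correction mass. Below it, r ≤ 42 gives 1 + r²ℓ ≤ 1 + 42² = 1765, and T ≥ 1 suffices.
  rcases lt_or_ge ((r : ℝ) * ℓ) 42 with hsmall | hbig
  · have h1 : (r : ℝ) ≤ 42 := by nlinarith
    nlinarith
  have hr : 1 ≤ r := by
    rcases Nat.eq_zero_or_pos r with rfl | h
    · norm_num at hbig
    · exact h
  have hmain := advantage_le_of_computes hp (error_lt_half hq0 r).le
    (m := r / 2) (by omega) (by omega) hr hrn ha
  rw [← hqdef] at hmain
  have h1 : 1 - 2 * (1 / 2 - 1 / (4 * q ^ ((r : ℝ) / 3))) = 1 / 2 * q ^ (-((r : ℝ) / 3)) := by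
    rw [Real.rpow_neg hq0.le]
    field_simp
    ring
  have h2 : 32 * q⁻¹ ^ (r - r / 2) ≤ 1 / 4 * q ^ (-((r : ℝ) / 3)) := by
    have h3 : q⁻¹ ^ (r - r / 2) ≤ q ^ (-((r : ℝ) / 2)) := by
      rw [inv_pow_eq_rpow hq0]
      refine Real.rpow_le_rpow_of_exponent_le (by linarith) ?_
      rw [neg_le_neg_iff, div_le_iff₀ (by norm_num)]
      exact_mod_cast (by omega : r ≤ (r - r / 2) * 2)
    have h4 : q ^ (-((r : ℝ) / 2)) = q ^ (-((r : ℝ) / 3)) * q ^ (-((r : ℝ) / 6)) := by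
      rw [← Real.rpow_add hq0]
      congr 1
      ring
    have h5 : q ^ (-((r : ℝ) / 6)) ≤ 1 / 128 := by
      calc q ^ (-((r : ℝ) / 6)) = (2 : ℝ) ^ (-((r : ℝ) * ℓ / 6)) := by
            conv_lhs => rw [hqℓ, ← Real.rpow_mul (by norm_num)]
            congr 1
            ring
        _ ≤ (2 : ℝ) ^ (-7 : ℝ) := Real.rpow_le_rpow_of_exponent_le (by norm_num) (by linarith)
        _ = 1 / 128 := by
            rw [Real.rpow_neg (by norm_num)]
            norm_num
    have h6 : 0 < q ^ (-((r : ℝ) / 3)) := by positivity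
    rw [h4] at h3
    nlinarith
  rw [h1] at hmain
  have h7 : witnessDecay q r = q ^ (-((r : ℝ) / 3)) * q ^ (-((r : ℝ) ^ 2 / 16)) := by
    rw [witnessDecay, ← Real.rpow_add hq0]
    congr 1
    ring
  have h8 : 0 < q ^ (-((r : ℝ) / 3)) := by positivity
  -- Half of the advantage q^(-r/3)/2 survives the correction mass, and the common factor q^(-r/3)
  -- cancels against the one kept in `witnessDecay`.
  have h9 : 1 / 4 ≤ 272 * 4 ^ p.cost * q ^ (-((r : ℝ) ^ 2 / 16)) := by
    rw [h7] at hmain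
    refine le_of_mul_le_mul_left (a := q ^ (-((r : ℝ) / 3))) ?_ h8
    linarith
  -- The 11 comes from 4 · 272 = 1088 ≤ 2^11.
  have h10 : (2 : ℝ) ^ ((r : ℝ) ^ 2 * ℓ / 16) ≤ 2 ^ (2 * (p.cost : ℝ) + 11) := by
    have h11 : q ^ (-((r : ℝ) ^ 2 / 16)) = ((2 : ℝ) ^ ((r : ℝ) ^ 2 * ℓ / 16))⁻¹ := by
      conv_lhs => rw [hqℓ, ← Real.rpow_mul (by norm_num)]
      rw [← Real.rpow_neg (by norm_num)]
      congr 1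
      ring
    have h12 : (2 : ℝ) ^ (2 * (p.cost : ℝ) + 11) = 4 ^ p.cost * 2048 := by
      rw [Real.rpow_add (by norm_num), Real.rpow_mul (by norm_num), Real.rpow_natCast]
      norm_num
    have h13 : 0 < (2 : ℝ) ^ ((r : ℝ) ^ 2 * ℓ / 16) := by positivity
    rw [h11, ← div_eq_mul_inv, le_div_iff₀ h13] at h9
    rw [h12]
    have h14 : (0 : ℝ) < 4 ^ p.cost := by positivity
    linarith
  have h15 := (Real.rpow_le_rpow_left_iff (by norm_num : (1 : ℝ) < 2)).1 h10
  linarith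

end LowerBound

theorem theorem1p7 :
    ∃ c : ℝ, 0 < c ∧
      ∀ (F : Type u) [Field F] [Fintype F] (a : F), a ≠ 0 → ∀ n r : ℕ, r < n →
        ENNReal.ofReal (c * (1 + (r : ℝ) ^ 2 * Real.logb 2 (Fintype.card F))) ≤
          (quantumComplexity (1 / 2 - 1 / (4 * (Fintype.card F : ℝ) ^ ((r : ℝ) / 3)))
            (rankDet F n r a) : ℝ≥0∞) := by
  refine ⟨1 / 1765, by norm_num, fun F _ _ a ha n r hrn => ?_⟩
  set z : ℝ := 1 / 1765 * (1 + (r : ℝ) ^ 2 * Real.logb 2 (Fintype.card F)) with hz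
  -- Costs are integers, so the real bound may be rounded up; this lets the infimum be taken in
  -- `ℕ∞`.
  have h : ((⌈z⌉₊ : ℕ) : ℕ∞) ≤
      quantumComplexity (1 / 2 - 1 / (4 * (Fintype.card F : ℝ) ^ ((r : ℝ) / 3)))
        (rankDet F n r a) := by
    refine le_iInf₂ fun p hp => ?_
    rw [Nat.cast_le, Nat.ceil_le]
    have h1 := le_mul_cost_of_computes hp hrn ha
    rw [hz]
    linarith
  refine le_trans ?_ (ENat.toENNReal_mono h)
  rw [ENat.toENNReal_coe]
  exact ENNReal.ofReal_le_of_le_toReal (by simpa using Nat.le_ceil z)
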